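/- Conventions. $\widehat f(\xi)=\frac{1}{\sqrt{2\pi}}\int_{\mathbb R}f(x)e^{-i\xi x}\,dx$, extended to an isometry of $L_2=L_2(\mathbb R)$; $\mathbb T=[-\pi,\pi)$. A function $\psi:\mathbb R\to\mathbb C$ is called a regular generator if (A1) $\psi\in L_2$ and $\psi$ is positive definite, and (A2) $\sum_{j\in\mathbb Z}\|\widehat\psi(\cdot+2\pi j)\|_{L_\infty(\mathbb T)}<\infty$, $\delta_\psi:=\inf_{\mathbb T}|\widehat\psi|>0$ (essential infimum), and hence $C_\psi:=\delta_\psi^{-1}\sum_{j\ne0}\|\widehat\psi(\cdot+2\pi j)\|_{L_\infty(\mathbb T)}<\infty$. The Paley–Wiener space is $PW_\pi=\{f\in L_2:\widehat f=0\text{ a.e. outside }[-\pi,\pi]\}$, its elements being identified with their continuous representatives. A real sequence $(x_j)_{j\in\mathbb Z}$ is a complete interpolating sequence (CIS) for $PW_\pi$ if for every $(c_j)\in\ell_2(\mathbb Z)$ there is a unique $f\in PW_\pi$ with $f(x_j)=c_j$ for all $j$. For $\mathcal X=(x_j)$, $V(\psi,\mathcal X)$ is the closed linear span in $L_2$ of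 the translates $\psi(\cdot-x_j)$, $j\in\mathbb Z$; its elements are identified with their continuous representatives. For a regular generator $\phi$, an interpolant $I_\phi^{\mathcal Y}f$ of $f$ is a function $g\in V(\phi,\mathcal Y)$ with $g(y_k)=f(y_k)$ for all $k\in\mathbb Z$. Proposition. There exist a regular generator $\psi$ with $\operatorname{supp}\widehat\psi\supsetneq[-\pi,\pi]$ and two distinct CISs $\mathcal X\neq\mathcal Y$ for $PW_\pi$, namely the Gaussian $\psi(x)=e^{-x^2}$, $\mathcal Y=\mathbb Z$ and $\mathcal X=(\mathbb Z\setminus\{1\})\cup\{\sqrt2\}$ (listed in increasing order), such that no family $(\phi_\alpha)_{\alpha\in A}$ satisfying (B1), that is, with every $\phi_\alpha$ a regular generator, has interpolants $I_{\phi_\alpha}^{\mathcal Y}f$ that converge to $f$ in $L_2$ and uniformly on $\mathbb R$ for all $f\in V(\psi,\mathcal X)$. More explicitly: for every index set $A$, every proper filter on $A$ along which limits in $\alpha$ are taken, and every family $(\phi_\alpha)_{\alpha\in A}$ of regular generators, there is $f\in V(\psi,\mathcal X)$ such that for each $\alpha$ the interpolant $I_{\phi_\alpha}^{\mathcal Y}f\in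 V(\phi_\alpha,\mathcal Y)$ exists and is unique, but $I_{\phi_\alpha}^{\mathcal Y}f$ does not converge to $f$ both in $L_2(\mathbb R)$ and uniformly on $\mathbb R$. -/

import Mathlib

open Set Filter Topology MeasureTheory
open scoped ENNReal FourierTransform ComplexOrder

noncomputable section

namespace QuasiShift

/-- The torus, identified with the interval `[-π, π)`. -/
def torus : Set ℝ := Ico (-Real.pi) Real.pi

/-- The Fourier transform on `L₂(ℝ)` in the unitary angular-frequency normalization: the isometric
extension of `f ↦ (2π)^(-1/2) ∫ f(x) exp(-i ξ x) dx`, obtained by rescaling Mathlib's `L₂` Fourier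
transform, whose kernel is `exp(-2π i ξ x)`. It is defined up to equality almost everywhere. -/
def fourierL2 {f : ℝ → ℂ} (hf : MemLp f 2 (volume : Measure ℝ)) (ξ : ℝ) : ℂ :=
  ((Real.sqrt (2 * Real.pi))⁻¹ : ℝ) * (𝓕 (hf.toLp f) : Lp ℂ 2 (volume : Measure ℝ)) (ξ / (2 * Real.pi))

/-- The local norm `‖g(· + 2πj)‖` in `L_∞` of the torus. -/
def localSup (g : ℝ → ℂ) (j : ℤ) : ℝ≥0∞ :=
  eLpNorm (fun ξ : ℝ => g (ξ + 2 * Real.pi * j)) ∞ (volume.restrict torus)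

/-- The norm of the Wiener amalgam space `W(L_∞, ℓ_1)`. -/
def wienerNorm (g : ℝ → ℂ) : ℝ≥0∞ := ∑' j : ℤ, localSup g j

/-- The (essential) infimum of `|g|` over the torus. -/
def torusInf (g : ℝ → ℂ) : ℝ≥0∞ :=
  essInf (fun ξ : ℝ => ‖g ξ‖ₑ) (volume.restrict torus)

/-- The constant `C_ψ`, as a function of `g = ψ̂`. -/
def offCenterRatio (g : ℝ → ℂ) : ℝ≥0∞ :=
  (∑' j : {j : ℤ // j ≠ 0}, localSup g j) / torusInf g

/-- The essential (closed) support of a function defined up to null sets. -/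
def essSupport (g : ℝ → ℂ) : Set ℝ :=
  {ξ | ∀ U ∈ 𝓝 ξ, volume (U ∩ {η | g η ≠ 0}) ≠ 0}

/-- Positive definite functions on `ℝ`. -/
def IsPositiveDefinite (ψ : ℝ → ℂ) : Prop :=
  ∀ (n : ℕ) (x : Fin n → ℝ), (Matrix.of fun i j : Fin n => ψ (x i - x j)).PosSemidef

/-- Regular generators: positive definite `L₂` functions whose Fourier transform lies in `W(L_∞, ℓ_1)`,
is bounded away from zero on the torus, and has `C_ψ < ∞`. -/
structure IsRegularGenerator (ψ : ℝ → ℂ) : Prop where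
  memLp : MemLp ψ 2 (volume : Measure ℝ)
  posDef : IsPositiveDefinite ψ
  wiener : wienerNorm (fourierL2 memLp) < ∞
  inf_pos : 0 < torusInf (fourierL2 memLp)
  ratio : offCenterRatio (fourierL2 memLp) < ∞

/-- Membership in the Paley-Wiener space `PW_π`; its elements are represented by their continuous
representatives, so that point values make sense. -/
def IsPaleyWiener (f : ℝ → ℂ) : Prop :=
  Continuous f ∧ ∃ hf : MemLp f 2 (volume : Measure ℝ),
    ∀ᵐ ξ : ℝ, ξ ∉ Icc (-Real.pi) Real.pi → fourierL2 hf ξ = 0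

/-- Complete interpolating sequences for `PW_π`. -/
def IsCIS (X : ℤ → ℝ) : Prop :=
  ∀ c : ℤ → ℂ, Memℓp c 2 → ∃! f : ℝ → ℂ, IsPaleyWiener f ∧ ∀ j, f (X j) = c j

/-- The quasi shift-invariant space `V(ψ, X)`: the closure in `L₂(ℝ)` of the linear span of the
translates `ψ(· - x_j)`. -/
def quasiShiftSpace (ψ : ℝ → ℂ) (X : ℤ → ℝ) : Submodule ℂ (Lp ℂ 2 (volume : Measure ℝ)) :=
  (Submodule.span ℂ {g : Lp ℂ 2 (volume : Measure ℝ) |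
    ∃ j : ℤ, ⇑g =ᵐ[volume] fun x : ℝ => ψ (x - X j)}).topologicalClosure

/-- `f` is (the continuous representative of) an element of `V(ψ, X)`. -/
def MemV (ψ : ℝ → ℂ) (X : ℤ → ℝ) (f : ℝ → ℂ) : Prop :=
  Continuous f ∧ ∃ hf : MemLp f 2 (volume : Measure ℝ), hf.toLp f ∈ quasiShiftSpace ψ X

/-- `g` interpolates `f` at `Y` and belongs to `V(φ, Y)`. -/
def IsInterpolant (φ : ℝ → ℂ) (Y : ℤ → ℝ) (f g : ℝ → ℂ) : Prop :=
  MemV φ Y g ∧ ∀ k : ℤ, g (Y k) = f (Y k)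

/-- Convergence of `g_α` to `f` along `l`, both in `L₂(ℝ)` and uniformly on `ℝ`. -/
def ConvergesL2AndUniformly {A : Type*} (l : Filter A) (g : A → ℝ → ℂ) (f : ℝ → ℂ) : Prop :=
  Tendsto (fun α => eLpNorm (fun x => f x - g α x) 2 (volume : Measure ℝ)) l (𝓝 0) ∧
    TendstoUniformly g f l

end QuasiShift

end

noncomputable section

namespace QuasiShift

/-! The obstruction is a phase condition on the Fourier side. By
`IsPositiveDefinite.fourier_nonneg`, a regular generator has an almost everywhere nonnegative
transform `h`. By `Window.quasiShiftSpace_eq`, its integer shift space consists of the functions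
whose transform is a periodic multiple of `h` (frequency rescaled to period 1). Hence every `u` in
such a space satisfies `û(t + 1) * conj (û t) ≥ 0` for almost every `t` in a period cell. This
condition does not mention the generator and survives `L₂` limits (`fourier_phase_of_tendsto`), so
no choice of generators can reach a function that violates it.

The Gaussian translated by `y` violates it: its transform is a positive function times
`exp(-2πiyt)`, so the product above is a positive number times `exp(-2πiy)`, which is not real
unless `2y` is an integer. With `y = √2`, a node of the perturbed sequence, the translate lies in
the source space and is the counterexample `f` for every family at once.

The remaining claims need less. Interpolants at the integers exist and are unique because sampling
there periodizes the transform, and the periodization of `h` is bounded below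
(`Window.exists_memWindow`, `Window.eq_of_memWindow`). The Paley-Wiener space is the same situation
with `h` the indicator of the cell, which gives the sampling theorem. Moving one integer node to a
non-integer point costs a rank-one correction by a cardinal sine (`isCIS_update`). -/

/-! ### Exponentials and periodization over the unit cell -/

/-- The fundamental interval of the frequency variable. -/
def cell : Set ℝ := Ioc (-1 / 2) (1 / 2)

lemma measurableSet_cell : MeasurableSet cell := measurableSet_Ioc

/-- Lebesgue measure on the fundamental interval. -/
abbrev cellMeasure : Measure ℝ := volume.restrict cell

instance : IsFiniteMeasure cellMeasure := ⟨by simp [cellMeasure, cell]⟩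

/-- The exponential `t ↦ exp(2πixt)`. -/
def expo (x t : ℝ) : ℂ := Complex.exp (2 * Real.pi * Complex.I * x * t)

lemma norm_expo (x t : ℝ) : ‖expo x t‖ = 1 := by
  have : expo x t = Complex.exp ((2 * Real.pi * x * t : ℝ) * Complex.I) := by
    rw [expo]; congr 1; push_cast; ring
  rw [this, Complex.norm_exp_ofReal_mul_I]

lemma continuous_expo (x : ℝ) : Continuous (expo x) := by
  unfold expo; fun_prop

lemma expo_add_left (x y t : ℝ) : expo (x + y) t = expo x t * expo y t := by
  rw [expo, expo, expo, ← Complex.exp_add]; congr 1; push_cast; ring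

lemma expo_add_right (x s t : ℝ) : expo x (s + t) = expo x s * expo x t := by
  rw [expo, expo, expo, ← Complex.exp_add]; congr 1; push_cast; ring

lemma expo_int_int (k j : ℤ) : expo k j = 1 := by
  rw [expo, Complex.exp_eq_one_iff]
  exact ⟨k * j, by push_cast; ring⟩

lemma expo_int_add_int (k j : ℤ) (t : ℝ) : expo k (t + j) = expo k t := by
  rw [expo_add_right, expo_int_int, mul_one]

lemma expo_neg_left (x t : ℝ) : expo (-x) t = starRingEnd ℂ (expo x t) := by
  rw [expo, expo, ← Complex.exp_conj]; congr 1; simp [Complex.conj_ofNat]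

/-- The integers as the additive subgroup of `ℝ` generated by `1`. -/
def intEquivZMultiples : ℤ ≃ AddSubgroup.zmultiples (1 : ℝ) :=
  Equiv.ofBijective (fun j : ℤ => (⟨(j : ℝ), ⟨j, by simp⟩⟩ : AddSubgroup.zmultiples (1 : ℝ)))
    ⟨fun a b hab => by simpa using congrArg Subtype.val hab,
      fun ⟨x, n, hn⟩ => ⟨n, Subtype.ext (by simpa using hn)⟩⟩

lemma intEquivZMultiples_coe (j : ℤ) : (intEquivZMultiples j : ℝ) = j := rfl

lemma lintegral_eq_tsum_cell (f : ℝ → ℝ≥0∞) :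
    ∫⁻ t, f t = ∑' j : ℤ, ∫⁻ t in cell, f (t + j) := by
  have h := (isAddFundamentalDomain_Ioc (one_pos : (0 : ℝ) < 1) (-1 / 2)).lintegral_eq_tsum'' f
  rw [h]
  have e : cell = Ioc (-1 / 2 : ℝ) (-1 / 2 + 1) := by rw [cell]; norm_num
  rw [← e]
  rw [← intEquivZMultiples.tsum_eq]
  refine tsum_congr fun j => ?_
  congr 1; ext t
  simp [AddSubgroup.vadd_def, add_comm, intEquivZMultiples_coe]

/-- Only countably many translates occur, so one null set serves for a whole fibre `t + ℤ`. Together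
with its converse `ae_of_ae_cell_shift`, this allows arguments fibre by fibre. -/
lemma ae_cell_shift {p : ℝ → Prop} (h : ∀ᵐ x, p x) : ∀ᵐ t ∂cellMeasure, ∀ j : ℤ, p (t + j) := by
  rw [ae_all_iff]
  intro j
  exact ae_restrict_of_ae ((measurePreserving_add_right volume (j : ℝ)).quasiMeasurePreserving.ae h)

lemma exists_cell_shift (x : ℝ) : ∃ j : ℤ, ∃ t ∈ cell, x = t + j := by
  refine ⟨⌈x - 1 / 2⌉, x - ⌈x - 1 / 2⌉, ?_, by ring⟩
  have h1 := Int.le_ceil (x - 1 / 2)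
  have h2 := Int.ceil_lt_add_one (x - 1 / 2)
  constructor <;> linarith

lemma ae_of_ae_cell_shift {p : ℝ → Prop} (h : ∀ᵐ t ∂cellMeasure, ∀ j : ℤ, p (t + j)) :
    ∀ᵐ x, p x := by
  rw [cellMeasure, ae_restrict_iff' measurableSet_cell] at h
  have h2 : ∀ᵐ x : ℝ, ∀ j : ℤ, x + j ∈ cell → ∀ i : ℤ, p (x + j + i) := by
    rw [ae_all_iff]
    intro j
    exact (measurePreserving_add_right volume (j : ℝ)).quasiMeasurePreserving.ae h
  filter_upwards [h2] with x hx
  obtain ⟨j, t, ht, rfl⟩ := exists_cell_shift x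
  have := hx (-j) (by simpa using ht) j
  simpa using this

lemma tsum_lintegral_cell_lt_top {Q : ℝ → ℂ} (hQ : Integrable Q) :
    ∑' j : ℤ, ∫⁻ t in cell, ‖Q (t + j)‖ₑ < ∞ := by
  rw [← lintegral_eq_tsum_cell (fun t => ‖Q t‖ₑ)]
  exact hQ.hasFiniteIntegral

lemma integrable_cell_shift {Q : ℝ → ℂ} (hQ : Integrable Q) (j : ℤ) :
    Integrable (fun t => Q (t + j)) cellMeasure :=
  (hQ.comp_add_right (j : ℝ)).restrict

lemma summable_integral_norm_cell {Q : ℝ → ℂ} (hQ : Integrable Q) :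
    Summable fun j : ℤ => ∫ t in cell, ‖Q (t + j)‖ := by
  have h := ENNReal.summable_toReal (tsum_lintegral_cell_lt_top hQ).ne
  refine h.congr fun j => ?_
  rw [integral_norm_eq_lintegral_enorm (integrable_cell_shift hQ j).1]

lemma integral_eq_tsum_cell {Q : ℝ → ℂ} (hQ : Integrable Q) :
    ∫ t, Q t = ∑' j : ℤ, ∫ t in cell, Q (t + j) := by
  have h := (isAddFundamentalDomain_Ioc (one_pos : (0 : ℝ) < 1) (-1 / 2)).integral_eq_tsum'' Q hQ
  rw [h]
  have e : cell = Ioc (-1 / 2 : ℝ) (-1 / 2 + 1) := by rw [cell]; norm_num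
  rw [← e]
  rw [← intEquivZMultiples.tsum_eq]
  refine tsum_congr fun j => ?_
  congr 1; ext t
  simp [AddSubgroup.vadd_def, add_comm, intEquivZMultiples_coe]

/-- Fubini for the sum over translates: the norms integrated over the translated cells are summable
because `Q` is integrable. -/
lemma integral_eq_integral_cell_tsum {Q : ℝ → ℂ} (hQ : Integrable Q) :
    ∫ t, Q t = ∫ t in cell, ∑' j : ℤ, Q (t + j) := by
  rw [integral_eq_tsum_cell hQ]
  exact (hasSum_integral_of_summable_integral_norm (integrable_cell_shift hQ)
    (summable_integral_norm_cell hQ)).tsum_eq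

lemma integrable_cell_tsum {Q : ℝ → ℂ} (hQ : Integrable Q) :
    Integrable (fun t => ∑' j : ℤ, Q (t + j)) cellMeasure := by
  have h : ∫⁻ t in cell, ∑' j : ℤ, ‖Q (t + j)‖ₑ ≠ ∞ := by
    rw [lintegral_tsum fun j => (integrable_cell_shift hQ j).1.enorm]
    exact (tsum_lintegral_cell_lt_top hQ).ne
  refine ⟨?_, lt_of_le_of_lt (lintegral_mono fun t => enorm_tsum_le_tsum_enorm) h.lt_top⟩
  exact AEStronglyMeasurable.tsum fun j => (integrable_cell_shift hQ j).1

/-! ### Uniqueness of Fourier coefficients -/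

/-- Integrable functions on the fundamental interval with vanishing Fourier coefficients vanish. -/
lemma ae_eq_zero_of_integral_expo_eq_zero {Q : ℝ → ℂ} (hQ : Integrable Q cellMeasure)
    (h : ∀ k : ℤ, ∫ t in cell, Q t * expo k t = 0) : ∀ᵐ t ∂cellMeasure, Q t = 0 := by
  have hint : ∀ c : C(AddCircle (1 : ℝ), ℂ),
      Integrable (fun t : ℝ => Q t * c (t : AddCircle (1 : ℝ))) cellMeasure := by
    intro c
    refine hQ.mul_bdd (c := ‖c‖) ?_ (Eventually.of_forall fun t => c.norm_coe_le_norm _)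
    exact (c.continuous.comp (AddCircle.continuous_mk' 1)).aestronglyMeasurable
  have hspan : ∀ c ∈ Submodule.span ℂ (Set.range (_root_.fourier (T := (1 : ℝ)))),
      ∫ t in cell, Q t * c (t : AddCircle (1 : ℝ)) = 0 := by
    intro c hc
    induction hc using Submodule.span_induction with
    | mem x hx =>
      obtain ⟨k, rfl⟩ := hx
      rw [← h k]
      congr 1; ext t
      rw [fourier_coe_apply, expo]
      congr 2; push_cast; ring
    | zero => simp
    | add x y _ _ hx hy =>
      simp only [ContinuousMap.add_apply, mul_add]
      rw [integral_add (hint x) (hint y), hx, hy, add_zero]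
    | smul a x _ hx =>
      simp only [ContinuousMap.smul_apply, smul_eq_mul, mul_left_comm _ a]
      rw [integral_const_mul, hx, mul_zero]
  -- Trigonometric polynomials are uniformly dense in the continuous functions on the circle, and
  -- pairing with an integrable `Q` is continuous for the uniform norm.
  have hall : ∀ c : C(AddCircle (1 : ℝ), ℂ), ∫ t in cell, Q t * c (t : AddCircle (1 : ℝ)) = 0 := by
    intro c
    have hc : c ∈ (Submodule.span ℂ (Set.range (_root_.fourier (T := (1 : ℝ))))).topologicalClosure := by
      rw [span_fourier_closure_eq_top]; trivial
    have hc' : c ∈ closure (Submodule.span ℂ (Set.range (_root_.fourier (T := (1 : ℝ)))) : Set _) := hc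
    obtain ⟨p, hp, hlim⟩ := mem_closure_iff_seq_limit.1 hc'
    have hb : ∀ n, ‖∫ t in cell, Q t * c (t : AddCircle (1 : ℝ))‖ ≤
        (∫ t in cell, ‖Q t‖) * ‖c - p n‖ := by
      intro n
      have e : ∫ t in cell, Q t * c (t : AddCircle (1 : ℝ)) =
          ∫ t in cell, Q t * (c - p n) (t : AddCircle (1 : ℝ)) := by
        simp only [ContinuousMap.sub_apply, mul_sub]
        rw [integral_sub (hint c) (hint (p n)), hspan _ (hp n), sub_zero]
      rw [e, ← integral_mul_const]
      refine norm_integral_le_of_norm_le (hQ.norm.mul_const _) (Eventually.of_forall fun t => ?_)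
      rw [norm_mul]
      gcongr
      exact (c - p n).norm_coe_le_norm _
    have hz : Tendsto (fun n => (∫ t in cell, ‖Q t‖) * ‖c - p n‖) atTop (𝓝 0) := by
      have : Tendsto (fun n => c - p n) atTop (𝓝 (c - c)) := tendsto_const_nhds.sub hlim
      simpa using (this.norm).const_mul (∫ t in cell, ‖Q t‖)
    exact norm_le_zero_iff.1 (ge_of_tendsto' hz hb)
  -- A test function supported in the open cell vanishes at both endpoints, so it descends to a
  -- continuous function on the circle. The endpoint lost is a null set.
  have hopen : ∀ᵐ t : ℝ, t ∈ Ioo (-1 / 2 : ℝ) (1 / 2) → Q t = 0 := by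
    refine isOpen_Ioo.ae_eq_zero_of_integral_contDiff_smul_eq_zero ?_ ?_
    · exact (IntegrableOn.mono_set hQ Ioo_subset_Ioc_self).locallyIntegrableOn
    · intro g hg _ hgs
      have hout : ∀ t ∉ Ioo (-1 / 2 : ℝ) (1 / 2), g t = 0 := fun t ht =>
        image_eq_zero_of_notMem_tsupport fun h' => ht (hgs h')
      have hcont : Continuous (AddCircle.liftIoc 1 (-1 / 2) fun t => (g t : ℂ)) := by
        refine AddCircle.liftIoc_continuous ?_ ?_
        · rw [hout _ (by simp), hout _ (by norm_num)]
        · have := hg.continuous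
          fun_prop
      rw [← hall ⟨_, hcont⟩, ← integral_indicator measurableSet_cell]
      congr 1; ext t
      by_cases ht : t ∈ Ioc (-1 / 2 : ℝ) (1 / 2)
      · rw [indicator_of_mem (by exact ht)]
        simp only [ContinuousMap.coe_mk]
        rw [AddCircle.liftIoc_coe_apply ⟨ht.1, by linarith [ht.2]⟩, Complex.real_smul, mul_comm]
      · rw [indicator_of_notMem (by exact ht), hout t fun h' => ht (Ioo_subset_Ioc_self h'), zero_smul]
  have e : cellMeasure = volume.restrict (Ioo (-1 / 2 : ℝ) (1 / 2)) :=
    (Measure.restrict_congr_set Ioo_ae_eq_Ioc).symm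
  rw [e, ae_restrict_iff' measurableSet_Ioo]
  exact hopen

lemma integrable_mul_expo {μ : Measure ℝ} {Q : ℝ → ℂ} (hQ : Integrable Q μ) (x : ℝ) :
    Integrable (fun t => Q t * expo x t) μ :=
  hQ.mul_bdd (c := 1) (continuous_expo x).aestronglyMeasurable
    (Eventually.of_forall fun t => (norm_expo x t).le)

lemma integral_mul_expo_int {Q : ℝ → ℂ} (hQ : Integrable Q) (k : ℤ) :
    ∫ t, Q t * expo k t = ∫ t in cell, (∑' j : ℤ, Q (t + j)) * expo k t := by
  rw [integral_eq_integral_cell_tsum (integrable_mul_expo hQ k)]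
  congr 1; ext t
  simp_rw [expo_int_add_int]
  exact tsum_mul_right

/-- The integrals over the line are the Fourier coefficients of the periodization. In applications
they are samples at the integers or inner products with integer translates. -/
lemma ae_tsum_eq_zero_of_integral_expo_eq_zero {Q : ℝ → ℂ} (hQ : Integrable Q)
    (h : ∀ k : ℤ, ∫ t, Q t * expo k t = 0) : ∀ᵐ t ∂cellMeasure, ∑' j : ℤ, Q (t + j) = 0 :=
  ae_eq_zero_of_integral_expo_eq_zero (integrable_cell_tsum hQ) fun k => by
    rw [← integral_mul_expo_int hQ, h]

/-! ### The `L₂` Fourier transform and Fourier integrals -/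

lemma fourierInv_eq_integral_expo (G : ℝ → ℂ) (x : ℝ) : 𝓕⁻ G x = ∫ t, G t * expo x t := by
  rw [Real.fourierInv_eq']
  congr 1; ext t
  rw [smul_eq_mul, mul_comm, expo]
  congr 2
  simp; ring

lemma fourier_eq_integral_expo (G : ℝ → ℂ) (x : ℝ) : 𝓕 G x = ∫ t, G t * expo (-x) t := by
  rw [← fourierInv_eq_integral_expo, Real.fourierInv_eq_fourier_neg, neg_neg]

lemma continuous_fourier {G : ℝ → ℂ} (hG : Integrable G) : Continuous (𝓕 G) :=
  VectorFourier.fourierIntegral_continuous Real.continuous_fourierChar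
    (innerSL ℝ).continuous₂ hG

lemma continuous_fourierInv {G : ℝ → ℂ} (hG : Integrable G) : Continuous (𝓕⁻ G) := by
  have : 𝓕⁻ G = fun x => 𝓕 G (-x) := funext fun x => Real.fourierInv_eq_fourier_neg G x
  rw [this]
  exact (continuous_fourier hG).comp continuous_neg

/-- Two locally integrable functions with the same pairings against Schwartz functions agree. -/
lemma ae_eq_of_forall_schwartz {u v : ℝ → ℂ} (hu : LocallyIntegrable u) (hv : LocallyIntegrable v)
    (h : ∀ g : SchwartzMap ℝ ℂ, ∫ x, g x • u x = ∫ x, g x • v x) : u =ᵐ[volume] v := by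
  have := ae_eq_zero_of_integral_contDiff_smul_eq_zero (hu.sub hv) fun g hg hgc => ?_
  · filter_upwards [this] with x hx
    simpa [sub_eq_zero] using hx
  · have hgc' : HasCompactSupport (fun x => (g x : ℂ)) := hgc.comp_left Complex.ofReal_zero
    have hgd : ContDiff ℝ (⊤ : ℕ∞) (fun x => (g x : ℂ)) := Complex.ofRealCLM.contDiff.comp hg
    have := h (hgc'.toSchwartzMap hgd)
    have hiu := hu.integrable_smul_left_of_hasCompactSupport hg.continuous hgc
    have hiv := hv.integrable_smul_left_of_hasCompactSupport hg.continuous hgc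
    simp only [Pi.sub_apply, smul_sub]
    rw [integral_sub hiu hiv, sub_eq_zero]
    simpa using this

/-- The multiplication formula, tested against Schwartz functions, is what identifies the
distributional transform of an `L₁ ∩ L₂` function with its Fourier integral. -/
lemma integral_fourier_mul_eq {f g : ℝ → ℂ} (hf : Integrable f) (hg : Integrable g) :
    ∫ x, 𝓕 f x • g x = ∫ x, f x • 𝓕 g x := by
  have := VectorFourier.integral_fourierIntegral_smul_eq_flip (L := innerₗ ℝ) (μ := volume)
    (ν := volume) Real.continuous_fourierChar (innerSL ℝ).continuous₂ hf hg
  rw [flip_innerₗ] at this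
  exact this

lemma integral_fourierInv_mul_eq {f g : ℝ → ℂ} (hf : Integrable f) (hg : Integrable g) :
    ∫ x, 𝓕⁻ f x • g x = ∫ x, f x • 𝓕⁻ g x := by
  rw [Real.fourierInv_eq_fourier_comp_neg f, integral_fourier_mul_eq hf.comp_neg hg,
    ← integral_neg_eq_self]
  simp [Real.fourierInv_eq_fourier_neg]

/-- On `L₁ ∩ L₂` the `L₂` Fourier transform is the Fourier integral. -/
lemma coeFn_fourier_toLp {f : ℝ → ℂ} (h1 : Integrable f) (h2 : MemLp f 2) :
    (𝓕 (h2.toLp f) : Lp ℂ 2 (volume : Measure ℝ)) =ᵐ[volume] 𝓕 f := by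
  refine ae_eq_of_forall_schwartz ((Lp.memLp _).locallyIntegrable (by norm_num))
    (continuous_fourier h1).locallyIntegrable fun g => ?_
  rw [← Lp.toTemperedDistribution_apply, ← Lp.fourier_toTemperedDistribution_eq,
    TemperedDistribution.fourier_apply, Lp.toTemperedDistribution_apply,
    ← integral_fourier_mul_eq g.integrable h1, SchwartzMap.fourier_coe]
  refine integral_congr_ae ?_
  filter_upwards [h2.coeFn_toLp] with x hx
  rw [hx]

/-- On `L₁ ∩ L₂` the `L₂` inverse Fourier transform is the inverse Fourier integral. -/
lemma coeFn_fourierInv_toLp {f : ℝ → ℂ} (h1 : Integrable f) (h2 : MemLp f 2) :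
    (𝓕⁻ (h2.toLp f) : Lp ℂ 2 (volume : Measure ℝ)) =ᵐ[volume] 𝓕⁻ f := by
  refine ae_eq_of_forall_schwartz ((Lp.memLp _).locallyIntegrable (by norm_num))
    (continuous_fourierInv h1).locallyIntegrable fun g => ?_
  rw [← Lp.toTemperedDistribution_apply, ← Lp.fourierInv_toTemperedDistribution_eq,
    TemperedDistribution.fourierInv_apply, Lp.toTemperedDistribution_apply,
    ← integral_fourierInv_mul_eq g.integrable h1, SchwartzMap.fourierInv_coe]
  refine integral_congr_ae ?_
  filter_upwards [h2.coeFn_toLp] with x hx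
  rw [hx]

lemma memLp_fourierInv {G : ℝ → ℂ} (h1 : Integrable G) (h2 : MemLp G 2) : MemLp (𝓕⁻ G) 2 :=
  (memLp_congr_ae (coeFn_fourierInv_toLp h1 h2)).1 (Lp.memLp _)

lemma fourier_toLp_fourierInv {G : ℝ → ℂ} (h1 : Integrable G) (h2 : MemLp G 2)
    (h : MemLp (𝓕⁻ G) 2 := memLp_fourierInv h1 h2) :
    𝓕 (h.toLp (𝓕⁻ G)) = h2.toLp G := by
  have : h.toLp (𝓕⁻ G) = 𝓕⁻ (h2.toLp G) := by
    refine Lp.ext ?_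
    exact h.coeFn_toLp.trans (coeFn_fourierInv_toLp h1 h2).symm
  rw [this, FourierTransform.fourier_fourierInv_eq]

/-- An `L₂` function whose transform is integrable is given by the inverse Fourier integral. -/
lemma ae_eq_fourierInv {f G : ℝ → ℂ} (hf : MemLp f 2) (h1 : Integrable G)
    (hG : (𝓕 (hf.toLp f) : Lp ℂ 2 (volume : Measure ℝ)) =ᵐ[volume] G) : f =ᵐ[volume] 𝓕⁻ G := by
  have h2 : MemLp G 2 := (memLp_congr_ae hG).1 (Lp.memLp _)
  have e : 𝓕 (hf.toLp f) = h2.toLp G := Lp.ext (hG.trans h2.coeFn_toLp.symm)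
  have e' : hf.toLp f = 𝓕⁻ (h2.toLp G) := by rw [← e, FourierTransform.fourierInv_fourier_eq]
  calc f =ᵐ[volume] hf.toLp f := hf.coeFn_toLp.symm
    _ =ᵐ[volume] 𝓕⁻ G := by rw [e']; exact coeFn_fourierInv_toLp h1 h2

lemma fourierInv_comp_sub (G : ℝ → ℂ) (y x : ℝ) :
    𝓕⁻ G (x - y) = 𝓕⁻ (fun t => G t * expo (-y) t) x := by
  rw [fourierInv_eq_integral_expo, fourierInv_eq_integral_expo]
  congr 1; ext t
  rw [sub_eq_add_neg, expo_add_left]; ring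

/-! ### Periodic functions and bounds on cells -/

/-- Square summable sequences are the Fourier coefficients of periodic functions that are square
integrable over a period. -/
lemma exists_periodic_of_memlp {c : ℤ → ℂ} (hc : Memℓp c 2) :
    ∃ F : ℝ → ℂ, StronglyMeasurable F ∧ MemLp F 2 cellMeasure ∧
      (∀ (t : ℝ) (j : ℤ), F (t + j) = F t) ∧ ∀ k : ℤ, ∫ t in cell, F t * expo k t = c k := by
  -- The index is reflected because `fourierCoeff` pairs with `exp(-2πikt)`, whereas `expo k` has
  -- the opposite sign.
  have hc' : Memℓp (fun k => c (-k)) 2 := by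
    rw [memℓp_gen_iff (by norm_num)] at hc ⊢
    exact (Equiv.neg ℤ).summable_iff.2 hc
  set Fc := (fourierBasis (T := (1 : ℝ))).repr.symm (⟨fun k => c (-k), hc'⟩ : lp (fun _ : ℤ => ℂ) 2) with hFc
  have hcoef : ∀ k : ℤ, fourierCoeff (Fc : AddCircle (1 : ℝ) → ℂ) k = c (-k) := by
    intro k
    rw [← fourierBasis_repr, hFc, LinearIsometryEquiv.apply_symm_apply]
  have hmp : MeasurePreserving (fun t : ℝ => (t : AddCircle (1 : ℝ))) cellMeasure volume := by
    have := AddCircle.measurePreserving_mk 1 (-1 / 2)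
    rwa [show (-1 / 2 + 1 : ℝ) = 1 / 2 by norm_num] at this
  refine ⟨fun t => Fc (t : AddCircle (1 : ℝ)), ?_, ?_, ?_, ?_⟩
  · exact (Lp.stronglyMeasurable Fc).comp_measurable AddCircle.measurable_mk'
  · exact (Lp.memLp Fc).of_haarAddCircle.comp_measurePreserving hmp
  · intro t j
    have : ((t + j : ℝ) : AddCircle (1 : ℝ)) = t := by
      rw [AddCircle.coe_add, (AddCircle.coe_eq_zero_iff (x := (j : ℝ)) (1 : ℝ)).2 ⟨j, by simp⟩, add_zero]
    simp only [this]
  · intro k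
    have h := hcoef (-k)
    rw [fourierCoeff_eq_intervalIntegral _ _ (-1 / 2),
      intervalIntegral.integral_of_le (by norm_num), neg_neg] at h
    rw [← h, show (-1 / 2 + 1 : ℝ) = 1 / 2 by norm_num, cell]
    simp only [ne_eq, one_ne_zero, not_false_eq_true, div_self, one_smul]
    congr 1; ext t
    rw [fourier_coe_apply, expo, smul_eq_mul, mul_comm]
    congr 2; push_cast; ring

lemma tsum_enorm_sq_lt_top {M : ℤ → ℝ} (hM : Summable M) :
    ∑' j, ‖M j‖ₑ < ∞ ∧ ∑' j, ‖M j‖ₑ ^ 2 < ∞ := by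
  have h1 : ∑' j, ‖M j‖ₑ < ∞ := by
    have := hM.norm.tsum_ofReal_lt_top
    simpa only [ofReal_norm] using this
  refine ⟨h1, lt_of_le_of_lt (ENNReal.tsum_le_tsum (g := fun j => ‖M j‖ₑ * ∑' i, ‖M i‖ₑ)
    fun j => ?_) ?_⟩
  · rw [sq]; gcongr; exact ENNReal.le_tsum j
  · rw [ENNReal.tsum_mul_right]; exact ENNReal.mul_lt_top h1 h1

/-- A function dominated on each translate of the fundamental interval by a summable multiple of a
fixed `L₂` function is in `L₁ ∩ L₂`. -/
lemma integrable_memLp_of_cell_bound {G F : ℝ → ℂ} {M : ℤ → ℝ} (hG : AEStronglyMeasurable G)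
    (hM : Summable M) (hF : MemLp F 2 cellMeasure)
    (hb : ∀ᵐ t ∂cellMeasure, ∀ j : ℤ, ‖G (t + j)‖ ≤ M j * ‖F t‖) : Integrable G ∧ MemLp G 2 := by
  have hb' : ∀ᵐ t ∂cellMeasure, ∀ j : ℤ, ‖G (t + j)‖ₑ ≤ ‖M j‖ₑ * ‖F t‖ₑ := by
    filter_upwards [hb] with t ht j
    rw [← enorm_norm (F t), ← enorm_mul, enorm_le_iff_norm_le]
    exact (ht j).trans (Real.le_norm_self _)
  obtain ⟨h1, h2⟩ := tsum_enorm_sq_lt_top hM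
  have hF1 : Integrable F cellMeasure := hF.integrable (by norm_num)
  constructor
  · refine ⟨hG, ?_⟩
    rw [HasFiniteIntegral, lintegral_eq_tsum_cell]
    calc ∑' j : ℤ, ∫⁻ t in cell, ‖G (t + j)‖ₑ
        ≤ ∑' j : ℤ, ‖M j‖ₑ * ∫⁻ t in cell, ‖F t‖ₑ := by
          refine ENNReal.tsum_le_tsum fun j => ?_
          rw [← lintegral_const_mul' _ _ enorm_ne_top]
          refine lintegral_mono_ae ?_
          filter_upwards [hb'] with t ht using ht j
      _ < ∞ := by
          rw [ENNReal.tsum_mul_right]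
          exact ENNReal.mul_lt_top h1 hF1.hasFiniteIntegral
  · refine ⟨hG, ?_⟩
    rw [eLpNorm_lt_top_iff_lintegral_rpow_enorm_lt_top (by norm_num) (by norm_num),
      lintegral_eq_tsum_cell]
    have hF2 := hF.2
    rw [eLpNorm_lt_top_iff_lintegral_rpow_enorm_lt_top (by norm_num) (by norm_num)] at hF2
    simp only [ENNReal.toReal_ofNat, ENNReal.rpow_ofNat] at hF2 ⊢
    calc ∑' j : ℤ, ∫⁻ t in cell, ‖G (t + j)‖ₑ ^ 2
        ≤ ∑' j : ℤ, ‖M j‖ₑ ^ 2 * ∫⁻ t in cell, ‖F t‖ₑ ^ 2 := by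
          refine ENNReal.tsum_le_tsum fun j => ?_
          rw [← lintegral_const_mul' _ _ (by finiteness)]
          refine lintegral_mono_ae ?_
          filter_upwards [hb'] with t ht
          rw [← mul_pow]
          gcongr
          exact ht j
      _ < ∞ := by
          rw [ENNReal.tsum_mul_right]
          exact ENNReal.mul_lt_top h2 hF2

/-! ### Windows and interpolation at the integers -/

/-- Nonnegative functions on the frequency side dominated by a summable sequence over the integer
translates of the fundamental interval, and bounded below on the fundamental interval. -/
structure Window (h : ℝ → ℝ) (δ : ℝ) (M : ℤ → ℝ) : Prop where
  measurable : Measurable h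
  nonneg : ∀ t, 0 ≤ h t
  pos : 0 < δ
  summable : Summable M
  le : ∀ᵐ t ∂cellMeasure, ∀ j : ℤ, h (t + j) ≤ M j
  ge : ∀ᵐ t ∂cellMeasure, δ ≤ h t

/-- `G` is the product of `h` with a periodic function. -/
def Proportional (h : ℝ → ℝ) (G : ℝ → ℂ) : Prop :=
  ∀ᵐ t ∂cellMeasure, ∀ j : ℤ, G (t + j) * h t = G t * h (t + j)

lemma Proportional.congr {h : ℝ → ℝ} {G G' : ℝ → ℂ} (hG : Proportional h G)
    (e : G =ᵐ[volume] G') : Proportional h G' := by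
  filter_upwards [hG, ae_cell_shift e] with t h1 h2 j
  have h3 := h2 0
  simp only [Int.cast_zero, add_zero] at h3
  rw [← h2 j, ← h3, h1 j]

lemma Proportional.add {h : ℝ → ℝ} {G G' : ℝ → ℂ} (hG : Proportional h G)
    (hG' : Proportional h G') : Proportional h (G + G') := by
  filter_upwards [hG, hG'] with t h1 h2 j
  simp only [Pi.add_apply, add_mul, h1 j, h2 j]

lemma Proportional.const_smul {h : ℝ → ℝ} {G : ℝ → ℂ} (hG : Proportional h G) (a : ℂ) :
    Proportional h (a • G) := by
  filter_upwards [hG] with t h1 j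
  simp only [Pi.smul_apply, smul_eq_mul, mul_assoc, h1 j]

/-- Continuous `L₂` functions whose Fourier transform is the product of `h` with a periodic
function. -/
def MemWindow (h : ℝ → ℝ) (g : ℝ → ℂ) : Prop :=
  Continuous g ∧ ∃ hg : MemLp g 2 (volume : Measure ℝ),
    Proportional h (𝓕 (hg.toLp g) : Lp ℂ 2 (volume : Measure ℝ))

lemma MemWindow.add {h : ℝ → ℝ} {g g' : ℝ → ℂ} (hg : MemWindow h g) (hg' : MemWindow h g') :
    MemWindow h (g + g') := by
  obtain ⟨hc, hm, hp⟩ := hg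
  obtain ⟨hc', hm', hp'⟩ := hg'
  refine ⟨hc.add hc', hm.add hm', (hp.add hp').congr ?_⟩
  rw [MemLp.toLp_add, FourierTransform.fourier_add]
  exact (Lp.coeFn_add _ _).symm

lemma MemWindow.const_smul {h : ℝ → ℝ} {g : ℝ → ℂ} (hg : MemWindow h g) (a : ℂ) :
    MemWindow h (a • g) := by
  obtain ⟨hc, hm, hp⟩ := hg
  refine ⟨hc.const_smul a, hm.const_smul a, (hp.const_smul a).congr ?_⟩
  rw [MemLp.toLp_const_smul, FourierTransform.fourier_smul]
  exact (Lp.coeFn_smul _ _).symm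

lemma MemWindow.sub {h : ℝ → ℝ} {g g' : ℝ → ℂ} (hg : MemWindow h g) (hg' : MemWindow h g') :
    MemWindow h (g - g') := by
  rw [sub_eq_add_neg, ← neg_one_smul ℂ g']
  exact hg.add (hg'.const_smul _)

namespace Window

variable {h : ℝ → ℝ} {δ : ℝ} {M : ℤ → ℝ}

/-- Proportionality bounds `‖G (t + j)‖` by `M j / δ * ‖G t‖`, so square integrability on one cell
already controls the `L₁` norm on the line. This makes point values available through the inverse
Fourier integral. -/
lemma integrable_of_proportional (hw : Window h δ M) {G : ℝ → ℂ} (hG : MemLp G 2)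
    (hp : Proportional h G) : Integrable G := by
  refine (integrable_memLp_of_cell_bound (F := G) (M := fun j => M j / δ) hG.1
    (hw.summable.div_const δ) (hG.restrict _) ?_).1
  filter_upwards [hp, hw.le, hw.ge] with t h1 h2 h3 j
  have h4 := congrArg norm (h1 j)
  rw [norm_mul, norm_mul, Complex.norm_real, Complex.norm_real, Real.norm_of_nonneg (hw.nonneg _),
    Real.norm_of_nonneg (hw.nonneg _)] at h4
  have : ‖G (t + j)‖ * δ ≤ M j * ‖G t‖ := by
    calc ‖G (t + j)‖ * δ ≤ ‖G (t + j)‖ * h t := by gcongr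
      _ = h (t + j) * ‖G t‖ := by rw [h4, mul_comm]
      _ ≤ M j * ‖G t‖ := by gcongr; exact h2 j
  rw [div_mul_eq_mul_div, le_div_iff₀ hw.pos]
  exact this

lemma integrable_memLp (hw : Window h δ M) :
    Integrable (fun t => (h t : ℂ)) ∧ MemLp (fun t => (h t : ℂ)) 2 := by
  refine integrable_memLp_of_cell_bound (F := fun _ => 1)
    (Complex.measurable_ofReal.comp hw.measurable).aestronglyMeasurable hw.summable
    (memLp_const _) ?_
  filter_upwards [hw.le] with t ht j
  rw [Complex.norm_real, Real.norm_of_nonneg (hw.nonneg _)]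
  simpa using ht j

lemma ae_summable (hw : Window h δ M) : ∀ᵐ t ∂cellMeasure, Summable fun j : ℤ => h (t + j) := by
  filter_upwards [hw.le] with t ht
  exact Summable.of_nonneg_of_le (fun j => hw.nonneg _) ht hw.summable

lemma ae_le_tsum (hw : Window h δ M) : ∀ᵐ t ∂cellMeasure, δ ≤ ∑' j : ℤ, h (t + j) := by
  filter_upwards [hw.ae_summable, hw.ge] with t h1 h2
  refine h2.trans ?_
  simpa using h1.le_tsum 0 fun j _ => hw.nonneg _

/-- Proportional functions are determined by their periodization. -/
lemma ae_eq_zero_of_tsum_eq_zero (hw : Window h δ M) {G : ℝ → ℂ} (hp : Proportional h G)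
    (h0 : ∀ᵐ t ∂cellMeasure, ∑' j : ℤ, G (t + j) = 0) : G =ᵐ[volume] 0 := by
  refine ae_of_ae_cell_shift ?_
  filter_upwards [hp, h0, hw.ge, hw.ae_le_tsum] with t h1 h2 h3 h4
  have hP : (∑' j : ℤ, (h (t + j) : ℂ)) ≠ 0 := by
    rw [← Complex.ofReal_tsum]
    exact_mod_cast (hw.pos.trans_le h4).ne'
  -- Along a fibre, `G t` times the periodization of `h` equals `h t` times the periodization of
  -- `G`, which vanishes.
  have hG : G t = 0 := by
    have : G t * ∑' j : ℤ, (h (t + j) : ℂ) = 0 := by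
      rw [← tsum_mul_left]
      simp_rw [← h1]
      rw [tsum_mul_right, h2, zero_mul]
    exact (mul_eq_zero.1 this).resolve_right hP
  intro j
  have h5 := h1 j
  rw [hG, zero_mul] at h5
  exact (mul_eq_zero.1 h5).resolve_right (by exact_mod_cast (hw.pos.trans_le h3).ne')

lemma eq_fourierInv_of_memWindow (hw : Window h δ M) {g : ℝ → ℂ} (hc : Continuous g)
    (hg : MemLp g 2) (hp : Proportional h (𝓕 (hg.toLp g) : Lp ℂ 2 (volume : Measure ℝ))) :
    g = 𝓕⁻ ((𝓕 (hg.toLp g) : Lp ℂ 2 (volume : Measure ℝ)) : ℝ → ℂ) := by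
  have h1 := hw.integrable_of_proportional (Lp.memLp _) hp
  exact (Continuous.ae_eq_iff_eq volume hc (continuous_fourierInv h1)).1
    (ae_eq_fourierInv hg h1 EventuallyEq.rfl)

/-- The samples of `g` at the integers are the Fourier coefficients of its periodized transform, and
that periodization determines a proportional function. -/
lemma eq_zero_of_memWindow (hw : Window h δ M) {g : ℝ → ℂ} (hg : MemWindow h g)
    (h0 : ∀ k : ℤ, g k = 0) : g = 0 := by
  obtain ⟨hc, hm, hp⟩ := hg
  have h1 := hw.integrable_of_proportional (Lp.memLp _) hp
  have e := hw.eq_fourierInv_of_memWindow hc hm hp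
  have hz : ((𝓕 (hm.toLp g) : Lp ℂ 2 (volume : Measure ℝ)) : ℝ → ℂ) =ᵐ[volume] 0 := by
    refine hw.ae_eq_zero_of_tsum_eq_zero hp (ae_tsum_eq_zero_of_integral_expo_eq_zero h1 fun k => ?_)
    rw [← fourierInv_eq_integral_expo, ← e, h0]
  rw [e]
  ext x
  rw [Real.fourierInv_congr_ae hz, fourierInv_eq_integral_expo]
  simp

lemma eq_of_memWindow (hw : Window h δ M) {g g' : ℝ → ℂ} (hg : MemWindow h g)
    (hg' : MemWindow h g') (he : ∀ k : ℤ, g k = g' k) : g = g' :=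
  sub_eq_zero.1 (hw.eq_zero_of_memWindow (hg.sub hg') fun k => by simp [he k])

lemma memWindow_fourierInv {G : ℝ → ℂ} (h1 : Integrable G) (h2 : MemLp G 2)
    (hp : Proportional h G) : MemWindow h (𝓕⁻ G) :=
  ⟨continuous_fourierInv h1, memLp_fourierInv h1 h2, hp.congr (by
    rw [fourier_toLp_fourierInv h1 h2]; exact h2.coeFn_toLp.symm)⟩

/-- Every square summable sequence is interpolated at the integers. -/
lemma exists_memWindow (hw : Window h δ M) {c : ℤ → ℂ} (hc : Memℓp c 2) :
    ∃ g : ℝ → ℂ, MemWindow h g ∧ ∀ k : ℤ, g k = c k := by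
  obtain ⟨F, hFm, hF, hper, hcoef⟩ := exists_periodic_of_memlp hc
  set P : ℝ → ℝ := fun t => ∑' j : ℤ, h (t + j) with hPdef
  have hPm : Measurable P := Measurable.tsum fun j => hw.measurable.comp (measurable_add_const _)
  have hPper : ∀ (t : ℝ) (j : ℤ), P (t + j) = P t := by
    intro t j
    rw [hPdef]
    simp only
    rw [← (Equiv.addLeft j).tsum_eq (fun i : ℤ => h (t + i))]
    refine tsum_congr fun i => ?_
    simp [add_assoc]
  -- The periodic factor is chosen so that `G` periodizes to `F`, whose coefficients are the
  -- prescribed samples.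
  set G : ℝ → ℂ := fun t => F t / P t * h t with hG
  have hGj : ∀ (t : ℝ) (j : ℤ), G (t + j) = F t / P t * h (t + j) := by
    intro t j
    rw [hG]
    simp only
    rw [hper, hPper]
  have hGm : AEStronglyMeasurable G := by
    have h1 := hFm.measurable
    have h2 := hw.measurable
    exact Measurable.aestronglyMeasurable (by fun_prop)
  obtain ⟨h1, h2⟩ := integrable_memLp_of_cell_bound (M := fun j => M j / δ) hGm
    (hw.summable.div_const δ) hF (by
      filter_upwards [hw.le, hw.ae_le_tsum] with t h1 h2 j
      rw [hGj, norm_mul, norm_div, Complex.norm_real, Complex.norm_real,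
        Real.norm_of_nonneg (hw.nonneg _), Real.norm_of_nonneg (hw.pos.le.trans h2)]
      have hδ := hw.pos
      have hM : 0 ≤ M j := (hw.nonneg _).trans (h1 j)
      calc ‖F t‖ / P t * h (t + j) ≤ ‖F t‖ / δ * M j := by
            exact mul_le_mul (div_le_div_of_nonneg_left (norm_nonneg _) hδ h2) (h1 j)
              (hw.nonneg _) (by positivity)
        _ = M j / δ * ‖F t‖ := by ring)
  refine ⟨𝓕⁻ G, memWindow_fourierInv h1 h2 ?_, fun k => ?_⟩
  · refine Eventually.of_forall fun t j => ?_
    rw [hGj, hG]; ring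
  · rw [fourierInv_eq_integral_expo, integral_mul_expo_int h1, ← hcoef k]
    refine integral_congr_ae ?_
    filter_upwards [hw.ae_le_tsum] with t ht
    have hP : (P t : ℂ) ≠ 0 := by exact_mod_cast (hw.pos.trans_le ht).ne'
    simp only [hGj]
    rw [tsum_mul_left, ← Complex.ofReal_tsum]
    change F t / P t * (P t : ℂ) * _ = _
    rw [div_mul_cancel₀ _ hP]

end Window

/-! ### Integer shift spaces on the Fourier side -/

lemma memLp_mul_expo {G : ℝ → ℂ} (hG : MemLp G 2) (x : ℝ) : MemLp (fun t => G t * expo x t) 2 :=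
  (memLp_congr_norm (hG.1.mul (continuous_expo x).aestronglyMeasurable) hG.1
    (Eventually.of_forall fun t => by simp [norm_expo])).2 hG

/-- Translation becomes modulation under the `L₂` Fourier transform. -/
lemma ae_eq_fourierInv_translate {φ G : ℝ → ℂ} (hφ : MemLp φ 2) (h1 : Integrable G)
    (hG : (𝓕 (hφ.toLp φ) : Lp ℂ 2 (volume : Measure ℝ)) =ᵐ[volume] G) (y : ℝ) :
    (fun x => φ (x - y)) =ᵐ[volume] 𝓕⁻ fun t => G t * expo (-y) t := by
  have := (measurePreserving_sub_right volume y).quasiMeasurePreserving.ae_eq_comp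
    (ae_eq_fourierInv hφ h1 hG)
  filter_upwards [this] with x hx
  rw [← fourierInv_comp_sub]
  exact hx

lemma fourier_translate {φ G : ℝ → ℂ} (hφ : MemLp φ 2) (h1 : Integrable G)
    (hG : (𝓕 (hφ.toLp φ) : Lp ℂ 2 (volume : Measure ℝ)) =ᵐ[volume] G) {y : ℝ}
    {u : Lp ℂ 2 (volume : Measure ℝ)} (hu : u =ᵐ[volume] fun x => φ (x - y)) :
    (𝓕 u : Lp ℂ 2 (volume : Measure ℝ)) =ᵐ[volume] fun t => G t * expo (-y) t := by
  have h2 : MemLp G 2 := (memLp_congr_ae hG).1 (Lp.memLp _)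
  have h1' := integrable_mul_expo h1 (-y)
  have h2' := memLp_mul_expo h2 (-y)
  have e : u = (memLp_fourierInv h1' h2').toLp _ :=
    Lp.ext ((hu.trans (ae_eq_fourierInv_translate hφ h1 hG y)).trans (MemLp.coeFn_toLp _).symm)
  rw [e, fourier_toLp_fourierInv h1' h2']
  exact h2'.coeFn_toLp

/-- The `L₂` functions whose Fourier transform is a periodic multiple of `h`. -/
def windowSubmodule (h : ℝ → ℝ) : Submodule ℂ (Lp ℂ 2 (volume : Measure ℝ)) where
  carrier := {u | Proportional h (𝓕 u : Lp ℂ 2 (volume : Measure ℝ))}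
  add_mem' {u v} hu hv := (Proportional.add hu hv).congr (by
    rw [FourierTransform.fourier_add]; exact (Lp.coeFn_add _ _).symm)
  zero_mem' := by
    have e : (𝓕 (0 : Lp ℂ 2 (volume : Measure ℝ)) : Lp ℂ 2 (volume : Measure ℝ)) = 0 :=
      (Lp.fourierTransformₗᵢ ℝ ℂ).map_zero
    have : Proportional h (0 : ℝ → ℂ) := Eventually.of_forall fun t j => by simp
    exact this.congr (by rw [e]; exact (Lp.coeFn_zero ..).symm)
  smul_mem' a u hu := (Proportional.const_smul hu a).congr (by
    rw [FourierTransform.fourier_smul]; exact (Lp.coeFn_smul _ _).symm)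

lemma mem_windowSubmodule {h : ℝ → ℝ} {u : Lp ℂ 2 (volume : Measure ℝ)} :
    u ∈ windowSubmodule h ↔ Proportional h (𝓕 u : Lp ℂ 2 (volume : Measure ℝ)) := Iff.rfl

/-- A sequence converging in `L₂` has a subsequence whose Fourier transforms converge at almost
every point of the fundamental interval together with all its integer translates. -/
lemma exists_subseq_fourier_tendsto {u : ℕ → Lp ℂ 2 (volume : Measure ℝ)}
    {v : Lp ℂ 2 (volume : Measure ℝ)} (hu : Tendsto u atTop (𝓝 v)) :
    ∃ ns : ℕ → ℕ, ∀ᵐ t ∂cellMeasure, ∀ j : ℤ,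
      Tendsto (fun n => (𝓕 (u (ns n)) : Lp ℂ 2 (volume : Measure ℝ)) (t + j)) atTop
        (𝓝 ((𝓕 v : Lp ℂ 2 (volume : Measure ℝ)) (t + j))) := by
  have h1 : Tendsto (fun n => (𝓕 (u n) : Lp ℂ 2 (volume : Measure ℝ))) atTop (𝓝 (𝓕 v)) :=
    ((Lp.fourierTransformₗᵢ ℝ ℂ).continuous.tendsto v).comp hu
  obtain ⟨ns, _, h2⟩ := (tendstoInMeasure_of_tendsto_Lp h1).exists_seq_tendsto_ae
  exact ⟨ns, ae_cell_shift h2⟩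

/-- Along an almost everywhere convergent subsequence of transforms, the cross-multiplied identity
defining `Proportional` passes to the limit on each fibre. -/
lemma isClosed_windowSubmodule (h : ℝ → ℝ) :
    IsClosed (windowSubmodule h : Set (Lp ℂ 2 (volume : Measure ℝ))) := by
  refine IsSeqClosed.isClosed fun u v hu hv => ?_
  obtain ⟨ns, hns⟩ := exists_subseq_fourier_tendsto hv
  have hall : ∀ᵐ t ∂cellMeasure, ∀ n, ∀ j : ℤ,
      (𝓕 (u n) : Lp ℂ 2 (volume : Measure ℝ)) (t + j) * h t =
        (𝓕 (u n) : Lp ℂ 2 (volume : Measure ℝ)) t * h (t + j) := ae_all_iff.2 hu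
  change Proportional h _
  filter_upwards [hns, hall] with t h1 h2 j
  have h3 := h1 0
  simp only [Int.cast_zero, add_zero] at h3
  refine tendsto_nhds_unique ((h1 j).mul_const _) ?_
  simp_rw [h2]
  exact h3.mul_const _

/-- For a function whose Fourier transform is a window, the quasi shift-invariant space over the
integers consists of all functions whose Fourier transform is a periodic multiple of the window. -/
lemma Window.quasiShiftSpace_eq {h : ℝ → ℝ} {δ : ℝ} {M : ℤ → ℝ} (hw : Window h δ M)
    {φ : ℝ → ℂ} (hφ : MemLp φ 2)
    (hH : (𝓕 (hφ.toLp φ) : Lp ℂ 2 (volume : Measure ℝ)) =ᵐ[volume] fun t => (h t : ℂ)) :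
    quasiShiftSpace φ (fun j : ℤ => (j : ℝ)) = windowSubmodule h := by
  obtain ⟨h1, h2⟩ := hw.integrable_memLp
  apply le_antisymm
  · refine Submodule.topologicalClosure_minimal _ ?_ (isClosed_windowSubmodule h)
    rw [Submodule.span_le]
    rintro u ⟨k, hu⟩
    have hp : Proportional h fun t => (h t : ℂ) * expo (-k) t := by
      refine Eventually.of_forall fun t j => ?_
      have := expo_int_add_int (-k) j t
      push_cast at this
      simp only [this]
      ring
    exact hp.congr (fourier_translate hφ h1 hH hu).symm
  · intro u hu
    rw [quasiShiftSpace, ← Submodule.orthogonal_orthogonal_eq_closure, Submodule.mem_orthogonal]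
    intro w hw'
    rw [Submodule.mem_orthogonal] at hw'
    set U : Lp ℂ 2 (volume : Measure ℝ) := 𝓕 u with hU
    set W : Lp ℂ 2 (volume : Measure ℝ) := 𝓕 w with hW
    have hWh : Integrable fun t => W t * h t := (Lp.memLp W).integrable_mul h2
    -- Orthogonality of `w` to the translate by `k` says that the `k`-th Fourier coefficient of the
    -- periodization of `W * h` vanishes.
    have hper : ∀ᵐ t ∂cellMeasure, ∑' j : ℤ, W (t + j) * (h (t + j) : ℂ) = 0 := by
      refine ae_tsum_eq_zero_of_integral_expo_eq_zero hWh fun k => ?_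
      have hm : MemLp (fun x => φ (x - (k : ℝ))) 2 :=
        hφ.comp_measurePreserving (measurePreserving_sub_right volume (k : ℝ))
      have hin := hw' (hm.toLp _) (Submodule.subset_span ⟨k, hm.coeFn_toLp⟩)
      rw [← Lp.inner_fourier_eq, L2.inner_def] at hin
      rw [← hin]
      refine integral_congr_ae ?_
      filter_upwards [fourier_translate hφ h1 hH hm.coeFn_toLp] with t ht
      rw [ht, RCLike.inner_apply, map_mul, Complex.conj_ofReal, expo_neg_left, Complex.conj_conj]
      ring
    rw [← Lp.inner_fourier_eq, L2.inner_def,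
      integral_eq_integral_cell_tsum (L2.integrable_inner (𝕜 := ℂ) W U)]
    refine integral_eq_zero_of_ae ?_
    filter_upwards [hper, mem_windowSubmodule.1 hu, hw.ge] with t h3 h4 h5
    have h6 : (h t : ℂ) ≠ 0 := by exact_mod_cast (hw.pos.trans_le h5).ne'
    -- The factor `h t` turns `U (t + j)` into `U t * h (t + j)`, and the fibre sum becomes `U t`
    -- times the conjugate of the vanishing periodization.
    have h7 : (∑' j : ℤ, inner ℂ (W (t + j)) (U (t + j))) * (h t : ℂ) = 0 := by
      rw [← tsum_mul_right]
      have : ∀ j : ℤ, inner ℂ (W (t + j)) (U (t + j)) * (h t : ℂ) =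
          U t * starRingEnd ℂ (W (t + j) * (h (t + j) : ℂ)) := by
        intro j
        rw [RCLike.inner_apply, mul_right_comm, h4 j, map_mul, Complex.conj_ofReal]
        ring
      simp_rw [this]
      rw [tsum_mul_left, ← Complex.conj_tsum, h3, map_zero, mul_zero]
    exact (mul_eq_zero.1 h7).resolve_right h6

lemma Window.memV_iff {h : ℝ → ℝ} {δ : ℝ} {M : ℤ → ℝ} (hw : Window h δ M)
    {φ : ℝ → ℂ} (hφ : MemLp φ 2)
    (hH : (𝓕 (hφ.toLp φ) : Lp ℂ 2 (volume : Measure ℝ)) =ᵐ[volume] fun t => (h t : ℂ))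
    {g : ℝ → ℂ} : MemV φ (fun j : ℤ => (j : ℝ)) g ↔ MemWindow h g := by
  rw [MemV, hw.quasiShiftSpace_eq hφ hH]
  rfl

/-! ### The phase condition -/

/-- The functions with a Fourier transform proportional to a nonnegative window have transforms of
equal phase at points differing by an integer, and this passes to `L₂` limits. -/
lemma fourier_phase_of_tendsto {A : Type*} {l : Filter A} [l.NeBot]
    {h : A → ℝ → ℝ} {δ : A → ℝ} {M : A → ℤ → ℝ} (hw : ∀ α, Window (h α) (δ α) (M α))
    {u : A → Lp ℂ 2 (volume : Measure ℝ)} (hu : ∀ α, u α ∈ windowSubmodule (h α))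
    {v : Lp ℂ 2 (volume : Measure ℝ)} (hv : Tendsto u l (𝓝 v)) :
    ∀ᵐ t ∂cellMeasure, 0 ≤ (𝓕 v : Lp ℂ 2 (volume : Measure ℝ)) (t + 1) *
      starRingEnd ℂ ((𝓕 v : Lp ℂ 2 (volume : Measure ℝ)) t) := by
  -- The filter need not be countably generated, but the limit in a metric space is still reached by
  -- a sequence of members of the family.
  have hex : ∀ n : ℕ, ∃ α, dist (u α) v < 1 / ((n : ℝ) + 1) := fun n =>
    (Metric.tendsto_nhds.1 hv _ Nat.one_div_pos_of_nat).exists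
  choose a ha using hex
  have hlim : Tendsto (fun n => u (a n)) atTop (𝓝 v) :=
    tendsto_iff_dist_tendsto_zero.2 (squeeze_zero (fun _ => dist_nonneg) (fun n => (ha n).le)
      tendsto_one_div_add_atTop_nhds_zero_nat)
  obtain ⟨ns, hns⟩ := exists_subseq_fourier_tendsto hlim
  have hpos : ∀ᵐ t ∂cellMeasure, ∀ n, 0 ≤ (𝓕 (u (a n)) : Lp ℂ 2 (volume : Measure ℝ)) (t + 1) *
      starRingEnd ℂ ((𝓕 (u (a n)) : Lp ℂ 2 (volume : Measure ℝ)) t) := by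
    rw [ae_all_iff]
    intro n
    filter_upwards [mem_windowSubmodule.1 (hu (a n)), (hw (a n)).ge] with t h1 h2
    have h3 := h1 1
    have h4 : 0 < h (a n) t := (hw (a n)).pos.trans_le h2
    have h5 : (h (a n) t : ℂ) ≠ 0 := by exact_mod_cast h4.ne'
    rw [Int.cast_one, ← eq_div_iff h5] at h3
    -- The product at `t + 1` and `t` is `|û t|² * h (t + 1) / h t`.
    have h6 : (0 : ℝ) ≤ Complex.normSq ((𝓕 (u (a n)) : Lp ℂ 2 (volume : Measure ℝ)) t) *
        (h (a n) (t + 1) / h (a n) t) :=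
      mul_nonneg (Complex.normSq_nonneg _) (div_nonneg ((hw (a n)).nonneg _) h4.le)
    have h7 := Complex.zero_le_real.2 h6
    rw [h3]
    convert h7 using 1
    push_cast
    rw [← Complex.mul_conj]
    ring
  filter_upwards [hns, hpos] with t h1 h2
  have h3 := h1 0
  have h4 := h1 1
  simp only [Int.cast_zero, add_zero, Int.cast_one] at h3 h4
  exact ge_of_tendsto' (h4.mul ((Complex.continuous_conj.tendsto _).comp h3)) fun n => h2 (ns n)

/-! ### Positive definite functions have nonnegative transforms -/

lemma IsPositiveDefinite.zero_nonneg {φ : ℝ → ℂ} (hφ : IsPositiveDefinite φ) : 0 ≤ φ 0 := by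
  have h := (hφ 1 fun _ => 0).diag_nonneg (i := 0)
  simpa using h

/-- The determinant of the kernel matrix at the two points `s` and `0` is `‖φ 0‖² - ‖φ s‖²`, hence
this is nonnegative. -/
lemma IsPositiveDefinite.norm_le {φ : ℝ → ℂ} (hφ : IsPositiveDefinite φ) (s : ℝ) :
    ‖φ s‖ ≤ ‖φ 0‖ := by
  have h := hφ 2 ![s, 0]
  have h1 := h.det_nonneg
  have h2 : φ (-s) = starRingEnd ℂ (φ s) := by
    have := h.isHermitian.apply 1 0
    simpa using this.symm
  rw [Matrix.det_fin_two] at h1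
  simp only [Matrix.of_apply, Matrix.cons_val_zero, Matrix.cons_val_one, sub_self, sub_zero,
    zero_sub, h2, Complex.mul_conj] at h1
  have h3 : φ 0 = (‖φ 0‖ : ℂ) := Complex.eq_coe_norm_of_nonneg hφ.zero_nonneg
  rw [h3, ← Complex.ofReal_mul, ← Complex.ofReal_sub, Complex.zero_le_real,
    Complex.normSq_eq_norm_sq] at h1
  exact abs_le_of_sq_le_sq' (by nlinarith) (norm_nonneg _) |>.2

/-- The modulated kernel has nonnegative sums over all pairs of sample points. -/
lemma IsPositiveDefinite.sum_nonneg {φ : ℝ → ℂ} (hφ : IsPositiveDefinite φ) (ξ : ℝ) {n : ℕ}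
    (x : Fin n → ℝ) : 0 ≤ ∑ i, ∑ j, φ (x i - x j) * expo (-ξ) (x i - x j) := by
  -- Testing the kernel matrix on a vector of exponentials produces the modulation, since the
  -- conjugate of one exponential times another depends only on `x i - x j`.
  have h := (hφ n x).dotProduct_mulVec_nonneg fun i => expo ξ (x i)
  refine h.trans_eq ?_
  simp only [dotProduct, Matrix.mulVec, Matrix.of_apply, Pi.star_apply, Finset.mul_sum]
  refine Finset.sum_congr rfl fun i _ => Finset.sum_congr rfl fun j _ => ?_
  have e1 : expo (-ξ) (x i - x j) = expo (-ξ) (x i) * expo ξ (x j) := by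
    rw [sub_eq_add_neg, expo_add_right]
    congr 1
    rw [expo, expo]; congr 1; push_cast; ring
  rw [e1, expo_neg_left]
  simp only [RCLike.star_def]
  ring

section Sampling

open ProbabilityTheory
open scoped NNReal

lemma map_sub_pi_gaussianReal {n : ℕ} (v : ℝ≥0) {i j : Fin n} (hij : i ≠ j) :
    (Measure.pi fun _ : Fin n => gaussianReal 0 v).map (fun x => x i - x j) =
      gaussianReal 0 (v + v) := by
  have hi : iIndepFun (fun (i : Fin n) (x : Fin n → ℝ) => x i)
      (Measure.pi fun _ : Fin n => gaussianReal 0 v) :=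
    iIndepFun_pi (X := fun _ x => x) fun _ => aemeasurable_id
  have hind := (hi.indepFun hij).neg_right
  have h1 : (Measure.pi fun _ : Fin n => gaussianReal 0 v).map (fun x => x i) = gaussianReal 0 v :=
    (measurePreserving_eval _ i).map_eq
  have h2 : (Measure.pi fun _ : Fin n => gaussianReal 0 v).map (-fun x => x j) =
      gaussianReal 0 v := by
    have := (measurePreserving_eval (fun _ : Fin n => gaussianReal 0 v) j).map_eq
    have e : (-fun x : Fin n → ℝ => x j) = (fun y : ℝ => -y) ∘ Function.eval j := rfl
    rw [e, ← Measure.map_map (g := fun y : ℝ => -y) measurable_neg (measurable_pi_apply j), this, gaussianReal_map_neg,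
      neg_zero]
  have := gaussianReal_add_gaussianReal_of_indepFun hind h1 h2
  rw [add_zero] at this
  rw [← this]
  congr 1

/-- Averaging the sums over independent Gaussian sample points shows that Gaussian averages of a
modulated positive definite function are nonnegative. -/
lemma IsPositiveDefinite.integral_gaussianReal_nonneg {φ : ℝ → ℂ} (hφ : IsPositiveDefinite φ)
    (hm : AEStronglyMeasurable φ) (ξ : ℝ) {v : ℝ≥0} (hv : v ≠ 0) :
    0 ≤ ∫ d, φ d * expo (-ξ) d ∂gaussianReal 0 (v + v) := by
  set q : ℝ → ℂ := fun d => φ d * expo (-ξ) d with hq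
  set I := ∫ d, q d ∂gaussianReal 0 (v + v) with hI
  have hvv : v + v ≠ 0 := by positivity
  have hqm : AEStronglyMeasurable q (gaussianReal 0 (v + v)) :=
    (hm.mul (continuous_expo (-ξ)).aestronglyMeasurable).mono_ac
      (gaussianReal_absolutelyContinuous 0 hvv)
  have hqi : Integrable q (gaussianReal 0 (v + v)) :=
    Integrable.of_bound hqm ‖φ 0‖ (Eventually.of_forall fun d => by
      rw [hq, norm_mul, norm_expo, mul_one]; exact hφ.norm_le d)
  have hq0 : q 0 = φ 0 := by simp [hq, expo]
  -- In expectation the `n` diagonal terms contribute `φ 0` each and the `n * (n - 1)` off-diagonal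
  -- terms `I` each. The quadratic growth in `n` forces the sign of `I`.
  have key : ∀ n : ℕ, 0 ≤ (n : ℂ) * φ 0 + (n * (n - 1) : ℂ) * I := by
    intro n
    set P := Measure.pi fun _ : Fin n => gaussianReal 0 v with hP
    have hmeas : ∀ i j : Fin n, Measurable fun x : Fin n → ℝ => x i - x j := fun i j => by fun_prop
    have hint : ∀ i j : Fin n, Integrable (fun x : Fin n → ℝ => q (x i - x j)) P := by
      intro i j
      rcases eq_or_ne i j with rfl | hij
      · simp
      · have := hqi
        rw [← map_sub_pi_gaussianReal v hij] at this
        exact this.comp_measurable (hmeas i j)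
    have hval : ∀ i j : Fin n, ∫ x, q (x i - x j) ∂P = if i = j then φ 0 else I := by
      intro i j
      split_ifs with hij
      · subst hij; simp [hq0]
      · rw [hI, ← map_sub_pi_gaussianReal v hij,
          integral_map (hmeas i j).aemeasurable (by rwa [map_sub_pi_gaussianReal v hij])]
    have hsum : ∫ x, ∑ i, ∑ j, q (x i - x j) ∂P = (n : ℂ) * φ 0 + (n * (n - 1) : ℂ) * I := by
      rw [integral_finsetSum _ fun i _ => integrable_finsetSum _ fun j _ => hint i j]
      simp_rw [integral_finsetSum _ fun j _ => hint _ j, hval]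
      have : ∀ i : Fin n, (∑ j : Fin n, if i = j then φ 0 else I) = φ 0 + (n - 1) * I := by
        intro i
        have e : ∀ j : Fin n, (if i = j then φ 0 else I) = I + if i = j then φ 0 - I else 0 := by
          intro j; split_ifs <;> ring
        simp_rw [e]
        rw [Finset.sum_add_distrib, Finset.sum_ite_eq]
        simp
        ring
      simp_rw [this]
      simp
      ring
    rw [← hsum]
    exact integral_nonneg fun x => hφ.sum_nonneg ξ x
  have h0 := hφ.zero_nonneg
  rw [Complex.le_def] at h0
  have hk : ∀ n : ℕ, 0 ≤ (n : ℝ) * (φ 0).re + n * (n - 1) * I.re ∧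
      (0 : ℝ) = (n : ℝ) * (φ 0).im + n * (n - 1) * I.im := by
    intro n
    have h := Complex.le_def.1 (key n)
    have e : (n : ℂ) * φ 0 + (n * (n - 1) : ℂ) * I =
        ((n : ℝ) : ℂ) * φ 0 + ((n * (n - 1) : ℝ) : ℂ) * I := by push_cast; ring
    rw [e] at h
    simpa only [Complex.add_re, Complex.add_im, Complex.re_ofReal_mul, Complex.im_ofReal_mul,
      Complex.zero_re, Complex.zero_im] using h
  rw [Complex.le_def]
  constructor
  · by_contra! hneg
    simp only [Complex.zero_re] at hneg
    -- With `n + 1` sample points the real part is `(n + 1) * ((φ 0).re + n * I.re)`, negative for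
    -- this `n`.
    obtain ⟨n, hn⟩ := exists_nat_gt ((φ 0).re / -I.re)
    rw [div_lt_iff₀ (by linarith)] at hn
    have h1 := (hk (n + 1)).1
    push_cast at h1
    nlinarith
  -- Since `φ 0` is real, two sample points suffice to see that `I` is real.
  · have h1 := (hk 2).2
    have h2 : (φ 0).im = 0 := h0.2.symm
    rw [h2] at h1
    norm_num at h1
    simpa using h1.symm

/-- Up to a positive constant, the damping factor is the density of the centred Gaussian of variance
`2v`, the law of the difference of two sample points. -/
lemma IsPositiveDefinite.fourier_mul_gaussian_nonneg {φ : ℝ → ℂ} (hφ : IsPositiveDefinite φ)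
    (hm : AEStronglyMeasurable φ) {v : ℝ≥0} (hv : v ≠ 0) (ξ : ℝ) :
    0 ≤ 𝓕 (fun d : ℝ => φ d * (Real.exp (-(4 * (v : ℝ))⁻¹ * d ^ 2) : ℂ)) ξ := by
  have h := hφ.integral_gaussianReal_nonneg hm ξ hv
  have hvv : v + v ≠ 0 := by positivity
  have hc : (0 : ℝ) < (√(2 * Real.pi * ((v + v : ℝ≥0) : ℝ)))⁻¹ := by
    have : (0 : ℝ) < ((v + v : ℝ≥0) : ℝ) := by positivity
    have := Real.pi_pos
    positivity
  rw [integral_gaussianReal_eq_integral_smul hvv] at h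
  rw [fourier_eq_integral_expo]
  have e : (∫ x, gaussianPDFReal 0 (v + v) x • (φ x * expo (-ξ) x)) =
      ((√(2 * Real.pi * ((v + v : ℝ≥0) : ℝ)))⁻¹ : ℝ) *
        ∫ t, φ t * (Real.exp (-(4 * (v : ℝ))⁻¹ * t ^ 2) : ℂ) * expo (-ξ) t := by
    rw [← integral_const_mul]
    congr 1; ext t
    rw [gaussianPDFReal, Complex.real_smul, Complex.ofReal_mul]
    have : -(t - 0) ^ 2 / (2 * ((v + v : ℝ≥0) : ℝ)) = -(4 * (v : ℝ))⁻¹ * t ^ 2 := by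
      have : (v : ℝ) ≠ 0 := by exact_mod_cast hv
      push_cast; field_simp; ring
    rw [this]
    ring
  rw [e] at h
  exact le_of_mul_le_mul_left (by simpa using h) (Complex.zero_lt_real.2 hc)

end Sampling

/-- Dominated convergence, with `(2‖φ‖)²` as dominating function. It removes the Gaussian damping as
the variance grows. -/
lemma tendsto_toLp_mul_of_tendsto_one {φ : ℝ → ℂ} (hφ : MemLp φ 2) {w : ℕ → ℝ → ℂ}
    (hb : ∀ n x, ‖w n x‖ ≤ 1) (hlim : ∀ x, Tendsto (fun n => w n x) atTop (𝓝 1))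
    (hm : ∀ n, MemLp (fun x => φ x * w n x) 2) :
    Tendsto (fun n => (hm n).toLp _) atTop (𝓝 (hφ.toLp φ)) := by
  rw [Lp.tendsto_Lp_iff_tendsto_eLpNorm'']
  have e : ∀ n, eLpNorm ((fun x => φ x * w n x) - φ) 2 volume =
      (∫⁻ x, ‖φ x * w n x - φ x‖ₑ ^ (2 : ℝ)) ^ (1 / 2 : ℝ) := by
    intro n
    rw [eLpNorm_eq_lintegral_rpow_enorm_toReal (by norm_num) (by norm_num)]
    simp
  simp_rw [e]
  have h0 : Tendsto (fun n => ∫⁻ x, ‖φ x * w n x - φ x‖ₑ ^ (2 : ℝ)) atTop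
      (𝓝 (∫⁻ _ : ℝ, 0)) := by
    refine tendsto_lintegral_of_dominated_convergence' (fun x => (2 * ‖φ x‖ₑ) ^ (2 : ℝ))
      (fun n => ((hm n).1.sub hφ.1).enorm.pow_const _) (fun n => Eventually.of_forall fun x => ?_)
      ?_ (Eventually.of_forall fun x => ?_)
    · refine ENNReal.rpow_le_rpow ?_ (by norm_num)
      refine enorm_sub_le.trans ?_
      rw [two_mul, enorm_mul]
      gcongr
      refine mul_le_of_le_one_right' ?_
      rw [← enorm_one (G := ℂ), enorm_le_iff_norm_le]
      simpa using hb n x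
    · simp_rw [ENNReal.mul_rpow_of_nonneg _ _ (show (0 : ℝ) ≤ 2 by norm_num)]
      rw [lintegral_const_mul' _ _ (by finiteness)]
      have := hφ.2
      rw [eLpNorm_lt_top_iff_lintegral_rpow_enorm_lt_top (by norm_num) (by norm_num)] at this
      exact (ENNReal.mul_lt_top (by finiteness) (by simpa using this)).ne
    · have h1 : Tendsto (fun n => φ x * w n x - φ x) atTop (𝓝 0) := by
        have := ((hlim x).const_mul (φ x)).sub_const (φ x)
        simpa using this
      have h2 := (ENNReal.continuous_rpow_const (y := (2 : ℝ))).tendsto _ |>.comp h1.enorm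
      simpa [Function.comp_def] using h2
  have h3 := (ENNReal.continuous_rpow_const (y := (1 / 2 : ℝ))).tendsto _ |>.comp h0
  simpa [Function.comp_def] using h3

/-- The `L₂` Fourier transform of a positive definite function is nonnegative. -/
lemma IsPositiveDefinite.fourier_nonneg {φ : ℝ → ℂ} (hφ : IsPositiveDefinite φ)
    (h2 : MemLp φ 2) :
    ∀ᵐ t, 0 ≤ (𝓕 (h2.toLp φ) : Lp ℂ 2 (volume : Measure ℝ)) t := by
  set w : ℕ → ℝ → ℂ := fun n x =>
    (Real.exp (-(4 * (((n : NNReal) + 1 : NNReal) : ℝ))⁻¹ * x ^ 2) : ℂ) with hw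
  have hwc : ∀ n, Continuous (w n) := fun n => by rw [hw]; fun_prop
  have hb : ∀ n x, ‖w n x‖ ≤ 1 := by
    intro n x
    rw [hw, Complex.norm_real, Real.norm_of_nonneg (Real.exp_nonneg _), Real.exp_le_one_iff]
    have : 0 ≤ (4 * (((n : NNReal) + 1 : NNReal) : ℝ))⁻¹ * x ^ 2 := by positivity
    linarith
  have hlim : ∀ x, Tendsto (fun n => w n x) atTop (𝓝 1) := by
    intro x
    have h1 : Tendsto (fun n : ℕ => -(4 * (((n : NNReal) + 1 : NNReal) : ℝ))⁻¹ * x ^ 2) atTop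
        (𝓝 0) := by
      have h := (tendsto_one_div_add_atTop_nhds_zero_nat (𝕜 := ℝ)).const_mul (-(1 / 4) * x ^ 2)
      rw [mul_zero] at h
      refine h.congr fun n => ?_
      push_cast
      field_simp
    have h3 := (Complex.continuous_ofReal.tendsto _).comp ((Real.continuous_exp.tendsto _).comp h1)
    rw [Real.exp_zero, Complex.ofReal_one] at h3
    exact h3
  have hm2 : ∀ n, MemLp (fun x => φ x * w n x) 2 := fun n =>
    h2.mono (h2.1.mul (hwc n).aestronglyMeasurable) (Eventually.of_forall fun x => by
      rw [norm_mul]; exact mul_le_of_le_one_right (norm_nonneg _) (hb n x))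
  have hwi : ∀ n, Integrable (w n) := by
    intro n
    have hpos : (0 : ℝ) < (4 * (((n : NNReal) + 1 : NNReal) : ℝ))⁻¹ := by positivity
    exact (integrable_exp_neg_mul_sq hpos).ofReal
  have hm1 : ∀ n, Integrable fun x => φ x * w n x := fun n =>
    (hwi n).bdd_mul (c := ‖φ 0‖) h2.1 (Eventually.of_forall hφ.norm_le)
  obtain ⟨ns, hns⟩ := exists_subseq_fourier_tendsto
    (tendsto_toLp_mul_of_tendsto_one h2 hb hlim hm2)
  have hpos : ∀ᵐ t, ∀ n, 0 ≤ (𝓕 ((hm2 n).toLp _) : Lp ℂ 2 (volume : Measure ℝ)) t := by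
    rw [ae_all_iff]
    intro n
    filter_upwards [coeFn_fourier_toLp (hm1 n) (hm2 n)] with t ht
    rw [ht]
    exact hφ.fourier_mul_gaussian_nonneg h2.1 (by positivity) t
  refine ae_of_ae_cell_shift ?_
  filter_upwards [hns, ae_cell_shift hpos] with t h3 h4 j
  exact ge_of_tendsto' (h3 j) fun n => h4 j _

/-! ### Regular generators as windows -/

lemma ae_comp_mul_left {p : ℝ → Prop} {c : ℝ} (hc : c ≠ 0) (h : ∀ᵐ x, p x) : ∀ᵐ x, p (c * x) :=
  (Measure.quasiMeasurePreserving_smul volume hc).ae h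

lemma ae_cell_of_ae_torus {p : ℝ → Prop} (h : ∀ᵐ ξ ∂volume.restrict torus, p ξ) :
    ∀ᵐ t ∂cellMeasure, p (2 * Real.pi * t) := by
  have hpi := Real.pi_pos
  rw [torus, Measure.restrict_congr_set Ico_ae_eq_Ioc, ae_restrict_iff' measurableSet_Ioc] at h
  rw [cellMeasure, ae_restrict_iff' measurableSet_cell]
  filter_upwards [ae_comp_mul_left (c := 2 * Real.pi) (by positivity) h] with t ht hmem
  exact ht ⟨by nlinarith [hmem.1], by nlinarith [hmem.2]⟩

lemma ae_torus_of_ae_cell {p : ℝ → Prop} (h : ∀ᵐ t ∂cellMeasure, p t) :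
    ∀ᵐ ξ ∂volume.restrict torus, p ((2 * Real.pi)⁻¹ * ξ) := by
  have hpi := Real.pi_pos
  rw [cellMeasure, ae_restrict_iff' measurableSet_cell] at h
  rw [torus, Measure.restrict_congr_set Ico_ae_eq_Ioc, ae_restrict_iff' measurableSet_Ioc]
  filter_upwards [ae_comp_mul_left (c := (2 * Real.pi)⁻¹) (by positivity) h] with t ht hmem
  refine ht ⟨?_, ?_⟩
  · rw [inv_mul_eq_div, lt_div_iff₀ (by positivity)]; linarith [hmem.1]
  · rw [inv_mul_eq_div, div_le_iff₀ (by positivity)]; linarith [hmem.2]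

/-- The normalizing factor relating the two conventions for the Fourier transform. -/
def normFactor : ℝ := (Real.sqrt (2 * Real.pi))⁻¹

lemma normFactor_pos : 0 < normFactor := by
  have := Real.pi_pos
  unfold normFactor; positivity

lemma fourierL2_two_pi_mul {f : ℝ → ℂ} (hf : MemLp f 2 (volume : Measure ℝ)) (t : ℝ) :
    fourierL2 hf (2 * Real.pi * t) =
      normFactor * (𝓕 (hf.toLp f) : Lp ℂ 2 (volume : Measure ℝ)) t := by
  rw [fourierL2, mul_div_cancel_left₀ _ Real.two_pi_pos.ne', normFactor]

/-- The Fourier transform of a regular generator is a window. -/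
lemma IsRegularGenerator.exists_window {φ : ℝ → ℂ} (hφ : IsRegularGenerator φ) :
    ∃ (h : ℝ → ℝ) (δ : ℝ) (M : ℤ → ℝ), Window h δ M ∧
      (𝓕 (hφ.memLp.toLp φ) : Lp ℂ 2 (volume : Measure ℝ)) =ᵐ[volume] fun t => (h t : ℂ) := by
  set H : Lp ℂ 2 (volume : Measure ℝ) := 𝓕 (hφ.memLp.toLp φ) with hH
  set g := fourierL2 hφ.memLp with hg
  have hfin : ∀ j, localSup g j ≠ ∞ := ENNReal.ne_top_of_tsum_ne_top hφ.wiener.ne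
  have hc := normFactor_pos
  -- A finite positive number below the essential infimum serves as a real lower bound without first
  -- showing that the infimum is finite.
  obtain ⟨d, hd0, hd⟩ := ENNReal.lt_iff_exists_nnreal_btwn.1 hφ.inf_pos
  have hbound : ∀ᵐ t ∂cellMeasure, ∀ j : ℤ, ‖H (t + j)‖ ≤ normFactor⁻¹ * (localSup g j).toReal := by
    rw [ae_all_iff]
    intro j
    have h1 : ∀ᵐ ξ ∂volume.restrict torus, ‖g (ξ + 2 * Real.pi * j)‖ₑ ≤ localSup g j := by
      rw [localSup, eLpNorm_exponent_top]
      exact ae_le_eLpNormEssSup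
    filter_upwards [ae_cell_of_ae_torus h1] with t ht
    rw [← mul_add, hg, fourierL2_two_pi_mul, ← hg] at ht
    have h2 := ENNReal.toReal_mono (hfin j) ht
    rw [toReal_enorm, norm_mul, Complex.norm_real, Real.norm_of_nonneg hc.le] at h2
    rwa [inv_mul_eq_div, le_div_iff₀ hc, mul_comm]
  have hlow : ∀ᵐ t ∂cellMeasure, normFactor⁻¹ * d ≤ ‖H t‖ := by
    have h1 : ∀ᵐ ξ ∂volume.restrict torus, torusInf g ≤ ‖g ξ‖ₑ := ae_essInf_le
    filter_upwards [ae_cell_of_ae_torus h1] with t ht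
    rw [hg, fourierL2_two_pi_mul, ← hg] at ht
    have h2 := ENNReal.toReal_mono enorm_ne_top (hd.le.trans ht)
    rw [toReal_enorm, norm_mul, Complex.norm_real, Real.norm_of_nonneg hc.le,
      ENNReal.coe_toReal] at h2
    rwa [inv_mul_eq_div, div_le_iff₀ hc, mul_comm]
  refine ⟨fun t => ‖H t‖, normFactor⁻¹ * d, fun j => normFactor⁻¹ * (localSup g j).toReal,
    ⟨(Lp.stronglyMeasurable H).measurable.norm, fun t => norm_nonneg _, ?_,
      (ENNReal.summable_toReal hφ.wiener.ne).mul_left _, hbound, hlow⟩, ?_⟩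
  · have : 0 < d := by exact_mod_cast hd0
    positivity
  · filter_upwards [hφ.posDef.fourier_nonneg hφ.memLp] with t ht
    exact Complex.eq_coe_norm_of_nonneg ht

/-- Positive definite functions whose Fourier transform is a window are regular generators. -/
lemma Window.isRegularGenerator {h : ℝ → ℝ} {δ : ℝ} {M : ℤ → ℝ} (hw : Window h δ M)
    {φ : ℝ → ℂ} (hφ : MemLp φ 2) (hpd : IsPositiveDefinite φ)
    (hH : (𝓕 (hφ.toLp φ) : Lp ℂ 2 (volume : Measure ℝ)) =ᵐ[volume] fun t => (h t : ℂ)) :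
    IsRegularGenerator φ := by
  have hc := normFactor_pos
  have hval : ∀ᵐ t ∂cellMeasure, ∀ j : ℤ,
      ‖fourierL2 hφ (2 * Real.pi * (t + j))‖ = normFactor * h (t + j) := by
    filter_upwards [ae_cell_shift hH] with t ht j
    rw [fourierL2_two_pi_mul, ht j, norm_mul, Complex.norm_real, Complex.norm_real,
      Real.norm_of_nonneg hc.le, Real.norm_of_nonneg (hw.nonneg _)]
  have hloc : ∀ j : ℤ, localSup (fourierL2 hφ) j ≤ ENNReal.ofReal (normFactor * M j) := by
    intro j
    rw [localSup, eLpNorm_exponent_top]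
    refine eLpNormEssSup_le_of_ae_bound ?_
    have h1 : ∀ᵐ t ∂cellMeasure, ‖fourierL2 hφ (2 * Real.pi * (t + j))‖ ≤ normFactor * M j := by
      filter_upwards [hval, hw.le] with t h1 h2
      rw [h1]
      exact mul_le_mul_of_nonneg_left (h2 j) hc.le
    filter_upwards [ae_torus_of_ae_cell h1] with ξ hξ
    rwa [mul_add, mul_inv_cancel_left₀ Real.two_pi_pos.ne'] at hξ
  have hwien : wienerNorm (fourierL2 hφ) < ∞ :=
    lt_of_le_of_lt (ENNReal.tsum_le_tsum hloc) (hw.summable.mul_left _).tsum_ofReal_lt_top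
  have hinf : 0 < torusInf (fourierL2 hφ) := by
    refine lt_of_lt_of_le (b := ENNReal.ofReal (normFactor * δ)) ?_ ?_
    · have := hw.pos
      rw [ENNReal.ofReal_pos]; positivity
    · refine le_essInf_of_ae_le _ ?_
      have h1 : ∀ᵐ t ∂cellMeasure, normFactor * δ ≤ ‖fourierL2 hφ (2 * Real.pi * t)‖ := by
        filter_upwards [hval, hw.ge] with t h1 h2
        have := h1 0
        rw [Int.cast_zero, add_zero] at this
        rw [this]
        exact mul_le_mul_of_nonneg_left h2 hc.le
      filter_upwards [ae_torus_of_ae_cell h1] with ξ hξ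
      rw [mul_inv_cancel_left₀ Real.two_pi_pos.ne'] at hξ
      rw [← ofReal_norm]
      exact ENNReal.ofReal_le_ofReal hξ
  refine ⟨hφ, hpd, hwien, hinf, ENNReal.div_lt_top ?_ hinf.ne'⟩
  exact (lt_of_le_of_lt (ENNReal.tsum_comp_le_tsum_of_injective Subtype.val_injective _)
    hwien).ne

/-! ### Paley-Wiener space and complete interpolating sequences -/

/-- Paley-Wiener functions are those with Fourier transform proportional to the indicator of the
fundamental interval. -/
lemma isPaleyWiener_iff {f : ℝ → ℂ} : IsPaleyWiener f ↔ MemWindow (cell.indicator 1) f := by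
  have hpi := Real.pi_pos
  have hc : (normFactor : ℂ) ≠ 0 := by exact_mod_cast normFactor_pos.ne'
  rw [IsPaleyWiener, MemWindow]
  refine and_congr_right fun _ => exists_congr fun hf => ?_
  set G : Lp ℂ 2 (volume : Measure ℝ) := 𝓕 (hf.toLp f) with hG
  have hcell : ∀ {t : ℝ} {j : ℤ}, t ∈ cell → t + j ∈ cell → j = 0 := by
    intro t j h1 h2
    have h3 : (j : ℝ) < 1 := by linarith [h1.1, h2.2]
    have h4 : (-1 : ℝ) < j := by linarith [h1.2, h2.1]
    have h5 : j < 1 := by exact_mod_cast h3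
    have h6 : -1 < j := by exact_mod_cast h4
    omega
  have e1 : (∀ᵐ ξ : ℝ, ξ ∉ Icc (-Real.pi) Real.pi → fourierL2 hf ξ = 0) ↔
      ∀ᵐ t : ℝ, t ∉ cell → G t = 0 := by
    constructor
    · intro h
      -- The frequency band is closed while the cell omits its left endpoint.
      have hne : ∀ᵐ t : ℝ, t ≠ -1 / 2 := by simp [ae_iff, measure_singleton]
      filter_upwards [ae_comp_mul_left (c := 2 * Real.pi) (by positivity) h, hne] with t h1 h2 h3
      rw [fourierL2_two_pi_mul] at h1
      refine (mul_eq_zero.1 (h1 fun h4 => h3 ⟨lt_of_le_of_ne ?_ h2.symm, ?_⟩)).resolve_left hc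
      · nlinarith [h4.1]
      · nlinarith [h4.2]
    · intro h
      filter_upwards [ae_comp_mul_left (c := (2 * Real.pi)⁻¹) (by positivity) h] with ξ h1 h2
      have h3 := fourierL2_two_pi_mul hf ((2 * Real.pi)⁻¹ * ξ)
      rw [mul_inv_cancel_left₀ Real.two_pi_pos.ne'] at h3
      rw [h3, h1, mul_zero]
      intro h4
      have e : ξ = 2 * Real.pi * ((2 * Real.pi)⁻¹ * ξ) := by
        rw [mul_inv_cancel_left₀ Real.two_pi_pos.ne']
      refine h2 ⟨?_, ?_⟩
      · rw [e]; nlinarith [h4.1]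
      · rw [e]; nlinarith [h4.2]
  rw [e1]
  constructor
  · intro h
    rw [Proportional, cellMeasure]
    filter_upwards [ae_cell_shift h, ae_restrict_mem measurableSet_cell] with t h1 h2 j
    by_cases h3 : t + j ∈ cell
    · rw [hcell h2 h3]; simp
    · rw [h1 j h3, indicator_of_notMem h3]; simp
  · intro h
    refine ae_of_ae_cell_shift ?_
    rw [Proportional, cellMeasure] at h
    filter_upwards [h, ae_restrict_mem measurableSet_cell] with t h1 h2 j h3
    have := h1 j
    rw [indicator_of_notMem h3, indicator_of_mem h2] at this
    simpa using this

lemma window_cell : Window (cell.indicator 1) 1 fun j => if j = 0 then 1 else 0 where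
  measurable := measurable_const.indicator measurableSet_cell
  nonneg t := indicator_nonneg (fun _ _ => zero_le_one) t
  pos := one_pos
  summable := summable_of_ne_finset_zero (s := {0}) fun j hj => by simpa using hj
  le := by
    filter_upwards [ae_restrict_mem measurableSet_cell] with t ht j
    split_ifs with hj
    · exact indicator_le_self' (fun _ _ => zero_le_one) _
    · refine (indicator_of_notMem (fun h => hj ?_) _).le
      have h3 : (j : ℝ) < 1 := by linarith [ht.1, h.2]
      have h4 : (-1 : ℝ) < j := by linarith [ht.2, h.1]
      have h5 : j < 1 := by exact_mod_cast h3
      have h6 : -1 < j := by exact_mod_cast h4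
      omega
  ge := by
    filter_upwards [ae_restrict_mem measurableSet_cell] with t ht
    rw [indicator_of_mem ht, Pi.one_apply]

/-- The sampling theorem: the integers form a complete interpolating sequence. -/
lemma isCIS_int : IsCIS fun j : ℤ => (j : ℝ) := by
  intro c hc
  obtain ⟨g, hg, hgc⟩ := window_cell.exists_memWindow hc
  refine ⟨g, ⟨isPaleyWiener_iff.2 hg, hgc⟩, fun g' hg' => ?_⟩
  exact window_cell.eq_of_memWindow (isPaleyWiener_iff.1 hg'.1) hg fun k => by
    rw [hgc k]; exact hg'.2 k

/-- The Paley-Wiener function that vanishes at all integers but one does not vanish at non-integer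
points. -/
lemma exists_cardinal_sine (m : ℤ) {y : ℝ} (hy : ∀ k : ℤ, y ≠ k) :
    ∃ s : ℝ → ℂ, MemWindow (cell.indicator 1) s ∧ (∀ k : ℤ, s k = if k = m then 1 else 0) ∧
      s y ≠ 0 := by
  set w : ℝ → ℂ := fun t => ((cell.indicator (1 : ℝ → ℝ) t : ℝ) : ℂ) with hwdef
  obtain ⟨h1, h2⟩ := window_cell.integrable_memLp
  set G : ℝ → ℂ := fun t => w t * expo (-m) t with hG
  have hval : ∀ x : ℝ, 𝓕⁻ G x = ∫ t in cell, expo (x - m) t := by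
    intro x
    rw [fourierInv_eq_integral_expo, ← integral_indicator measurableSet_cell]
    congr 1; ext t
    by_cases ht : t ∈ cell
    · simp only [hG, hwdef, indicator_of_mem ht, Pi.one_apply, Complex.ofReal_one, one_mul]
      rw [← expo_add_left]; congr 1; ring
    · simp [hG, hwdef, indicator_of_notMem ht]
  have hint : ∀ z : ℝ, z ≠ 0 →
      ∫ t in cell, expo z t = Complex.sin (Real.pi * z) / (Real.pi * z) := by
    intro z hz
    have hzc : (z : ℂ) ≠ 0 := by exact_mod_cast hz
    have hpic : (Real.pi : ℂ) ≠ 0 := by exact_mod_cast Real.pi_ne_zero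
    have hne : 2 * Real.pi * Complex.I * z ≠ 0 := by simp [hz, Real.pi_ne_zero]
    have := integral_exp_mul_complex (a := -1 / 2) (b := 1 / 2) hne
    rw [intervalIntegral.integral_of_le (by norm_num)] at this
    have e1 : 2 * Real.pi * Complex.I * z * ((1 / 2 : ℝ) : ℂ) = Real.pi * z * Complex.I := by
      push_cast; ring
    have e2 : 2 * Real.pi * Complex.I * z * ((-1 / 2 : ℝ) : ℂ) = -(Real.pi * z) * Complex.I := by
      push_cast; ring
    rw [e1, e2] at this
    simp only [expo, cell]
    rw [this, Complex.sin]
    field_simp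
    rw [Complex.I_sq]
    ring
  have h1' : Integrable G := integrable_mul_expo h1 _
  have h2' : MemLp G 2 := memLp_mul_expo h2 _
  refine ⟨𝓕⁻ G, Window.memWindow_fourierInv h1' h2' ?_, fun k => ?_, ?_⟩
  · refine Eventually.of_forall fun t j => ?_
    have := expo_int_add_int (-m) j t
    push_cast at this
    simp only [hG, hwdef, this]
    ring
  · rw [hval]
    split_ifs with hk
    · subst hk
      simp only [sub_self, expo, Complex.ofReal_zero, mul_zero, zero_mul, Complex.exp_zero, cell]
      norm_num
    · have hz : ((k : ℝ) - m) ≠ 0 := sub_ne_zero.2 (by exact_mod_cast hk)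
      rw [hint _ hz]
      have e : (Real.pi * (((k : ℝ) - m : ℝ) : ℂ) : ℂ) = ((k - m : ℤ) : ℂ) * Real.pi := by
        push_cast; ring
      rw [e, Complex.sin_int_mul_pi, zero_div]
  · have hz : y - m ≠ 0 := sub_ne_zero.2 (hy m)
    rw [hval, hint _ hz]
    have hzc : ((y - m : ℝ) : ℂ) ≠ 0 := by exact_mod_cast hz
    have hpic : (Real.pi : ℂ) ≠ 0 := by exact_mod_cast Real.pi_ne_zero
    refine div_ne_zero ?_ (mul_ne_zero hpic hzc)
    rw [← Complex.ofReal_mul, ← Complex.ofReal_sin, Complex.ofReal_ne_zero, Real.sin_ne_zero_iff]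
    intro n hn
    have : (n : ℝ) = y - m := mul_right_cancel₀ Real.pi_ne_zero (by rw [hn]; ring)
    exact hy (n + m) (by push_cast; linarith)

/-- Replacing one integer by a non-integer point leaves a complete interpolating sequence. -/
lemma isCIS_update (m : ℤ) {y : ℝ} (hy : ∀ k : ℤ, y ≠ k) :
    IsCIS fun j : ℤ => if j = m then y else j := by
  obtain ⟨s, hs, hsk, hsy⟩ := exists_cardinal_sine m hy
  intro c hc
  obtain ⟨g, hg, hgc⟩ := window_cell.exists_memWindow hc
  -- Adding a multiple of `s` changes no sample at an integer other than `m`; this multiple corrects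
  -- the value at `y`.
  set a := (c m - g y) / s y with ha
  refine ⟨g + a • s, ⟨isPaleyWiener_iff.2 (hg.add (hs.const_smul a)), fun j => ?_⟩, fun f hf => ?_⟩
  · change (g + a • s) (if j = m then y else j) = c j
    split_ifs with hj
    · subst hj
      simp only [Pi.add_apply, Pi.smul_apply, smul_eq_mul, ha]
      rw [div_mul_cancel₀ _ hsy]; ring
    · simp [hgc, hsk, hj]
  · obtain ⟨hf, hfc⟩ := hf
    have hf := isPaleyWiener_iff.1 hf
    -- The value of `f` at `m` is the only free integer sample, so `f` is `g` plus a multiple of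
    -- `s`; the value at `y` then fixes the multiple.
    set b := f m - c m with hb
    have e : f = g + b • s := by
      refine window_cell.eq_of_memWindow hf (hg.add (hs.const_smul b)) fun k => ?_
      simp only [Pi.add_apply, Pi.smul_apply, smul_eq_mul, hgc, hsk]
      by_cases hk : k = m
      · subst hk; simp [hb]
      · have := hfc k
        simp only [hk, if_false] at this ⊢
        rw [this]; ring
    have hfy := hfc m
    simp only [if_true] at hfy
    have hab : b = a := by
      rw [ha, eq_div_iff hsy, ← hfy]
      conv_rhs => rw [e]
      simp
    rw [e, hab]

/-! ### The Gaussian generator -/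

/-- The Gaussian generator. -/
def gaussian (x : ℝ) : ℂ := ((Real.exp (-x ^ 2) : ℝ) : ℂ)

/-- The Fourier transform of the Gaussian generator, with kernel `exp(-2πitx)`. -/
def gaussianHat (t : ℝ) : ℝ := √Real.pi * Real.exp (-Real.pi ^ 2 * t ^ 2)

lemma continuous_gaussian : Continuous gaussian := by
  unfold gaussian; fun_prop

lemma integrable_gaussian : Integrable gaussian := by
  have e : gaussian = fun x => ((Real.exp (-1 * x ^ 2) : ℝ) : ℂ) := by ext x; simp [gaussian]
  rw [e]
  exact (integrable_exp_neg_mul_sq one_pos).ofReal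

lemma memLp_gaussian : MemLp gaussian 2 := by
  rw [memLp_two_iff_integrable_sq_norm continuous_gaussian.aestronglyMeasurable]
  refine (integrable_exp_neg_mul_sq two_pos).congr (Eventually.of_forall fun x => ?_)
  simp only [gaussian]
  rw [Complex.norm_real, Real.norm_of_nonneg (Real.exp_nonneg _), ← Real.exp_nat_mul]
  congr 1; push_cast; ring

lemma fourier_gaussian_eq (t : ℝ) : 𝓕 gaussian t = gaussianHat t := by
  have h := fourier_gaussian_innerProductSpace (V := ℝ) (b := 1) (by simp) t
  have hsq : ∀ v : ℝ, ((‖v‖ : ℝ) : ℂ) ^ 2 = (v : ℂ) ^ 2 := fun v => by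
    rw [← Complex.ofReal_pow, Real.norm_eq_abs, sq_abs, Complex.ofReal_pow]
  have e : gaussian = fun v : ℝ => Complex.exp (-1 * (‖v‖ : ℂ) ^ 2) := by
    ext v
    rw [gaussian, Complex.ofReal_exp, hsq]
    push_cast; congr 1; ring
  rw [e, h, gaussianHat, hsq, Real.sqrt_eq_rpow, Complex.ofReal_mul,
    Complex.ofReal_cpow Real.pi_pos.le]
  push_cast
  simp

lemma coeFn_fourier_gaussian :
    (𝓕 (memLp_gaussian.toLp gaussian) : Lp ℂ 2 (volume : Measure ℝ)) =ᵐ[volume]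
      fun t => (gaussianHat t : ℂ) := by
  refine (coeFn_fourier_toLp integrable_gaussian memLp_gaussian).trans ?_
  exact Eventually.of_forall fun t => fourier_gaussian_eq t

lemma gaussianHat_pos (t : ℝ) : 0 < gaussianHat t := by
  have := Real.pi_pos
  unfold gaussianHat; positivity

lemma summable_exp_sub_abs (a : ℝ) : Summable fun j : ℤ => Real.exp (a - |(j : ℝ)|) := by
  have h : Summable fun n : ℕ => Real.exp (a - n) := by
    refine (Real.summable_exp_neg_nat.mul_left (Real.exp a)).congr fun n => ?_
    rw [← Real.exp_add, sub_eq_add_neg]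
  refine Summable.of_nat_of_neg ?_ ?_
  · simpa using h
  · simpa using h

/-- From `(|x| - 1)² ≥ 0` one gets `x² ≥ |x| - 1`. Exponential decay in `|j|` is enough for every
summability needed here. -/
lemma exp_neg_sq_le {x : ℝ} {j b : ℝ} (hb : |j| - b ≤ |x|) :
    Real.exp (-x ^ 2) ≤ Real.exp (1 + b - |j|) := by
  rw [Real.exp_le_exp]
  nlinarith [sq_nonneg (|x| - 1), sq_abs x, abs_nonneg x]

lemma exists_window_gaussianHat : ∃ (δ : ℝ) (M : ℤ → ℝ), Window gaussianHat δ M := by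
  have hpi := Real.pi_pos
  -- The lower bound uses only `t² ≤ 1` on the cell. In the upper bound `π² ≥ 1` is discarded, and
  -- the shift `1 / 2` bounds `|t|` on the cell.
  refine ⟨√Real.pi * Real.exp (-Real.pi ^ 2),
    fun j => √Real.pi * Real.exp (1 + 1 / 2 - |(j : ℝ)|), ?_, fun t => (gaussianHat_pos t).le,
    by positivity, (summable_exp_sub_abs _).mul_left _, ?_, ?_⟩
  · unfold gaussianHat; fun_prop
  · filter_upwards [ae_restrict_mem measurableSet_cell] with t ht j
    refine mul_le_mul_of_nonneg_left (le_trans ?_ (exp_neg_sq_le (x := t + j) ?_))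
      (Real.sqrt_nonneg _)
    · rw [Real.exp_le_exp]
      have : (1 : ℝ) ≤ Real.pi ^ 2 := by nlinarith [Real.pi_gt_three]
      nlinarith [sq_nonneg (t + (j : ℝ))]
    · have h1 : |t| ≤ 1 / 2 := abs_le.2 ⟨by linarith [ht.1], ht.2⟩
      have h2 : |(j : ℝ)| ≤ |t + j| + |t| := by
        calc |(j : ℝ)| = |(t + j) - t| := by ring_nf
          _ ≤ |t + j| + |t| := abs_sub _ _
      linarith
  · filter_upwards [ae_restrict_mem measurableSet_cell] with t ht
    refine mul_le_mul_of_nonneg_left ?_ (Real.sqrt_nonneg _)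
    rw [Real.exp_le_exp]
    have : t ^ 2 ≤ 1 := by nlinarith [ht.1, ht.2]
    nlinarith [sq_nonneg Real.pi]

/-- The kernel matrix of a characteristic function is the Gram matrix of exponentials in `L₂(μ)`. -/
lemma isPositiveDefinite_charFun (μ : Measure ℝ) [IsProbabilityMeasure μ] :
    IsPositiveDefinite (charFun μ) := by
  intro n x
  have hm : ∀ i : Fin n, MemLp (fun y : ℝ => Complex.exp (-(x i * y * Complex.I))) 2 μ := by
    intro i
    refine MemLp.of_bound (by fun_prop) 1 (Eventually.of_forall fun y => ?_)
    have : -(x i * y * Complex.I) = ((-(x i * y) : ℝ) : ℂ) * Complex.I := by push_cast; ring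
    rw [this, Complex.norm_exp_ofReal_mul_I]
  have h := Matrix.posSemidef_gram ℂ fun i => (hm i).toLp _
  have e : (Matrix.of fun i j : Fin n => charFun μ (x i - x j)) =
      Matrix.gram ℂ fun i => (hm i).toLp _ := ?_
  · rw [e]; exact h
  ext i j
  rw [Matrix.of_apply, Matrix.gram_apply, L2.inner_def, charFun_apply_real]
  refine integral_congr_ae ?_
  filter_upwards [(hm i).coeFn_toLp, (hm j).coeFn_toLp] with y h1 h2
  rw [h1, h2, RCLike.inner_apply, ← Complex.exp_conj, ← Complex.exp_add]
  congr 1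
  simp
  ring

lemma isPositiveDefinite_gaussian : IsPositiveDefinite gaussian := by
  have e : gaussian = charFun (ProbabilityTheory.gaussianReal 0 2) := by
    ext t
    rw [ProbabilityTheory.charFun_gaussianReal, gaussian, Complex.ofReal_exp]
    congr 1
    push_cast; ring
  rw [e]
  exact isPositiveDefinite_charFun _

lemma isRegularGenerator_gaussian : IsRegularGenerator gaussian := by
  obtain ⟨δ, M, hw⟩ := exists_window_gaussianHat
  exact hw.isRegularGenerator memLp_gaussian isPositiveDefinite_gaussian coeFn_fourier_gaussian

lemma essSupport_gaussian : essSupport (fourierL2 memLp_gaussian) = univ := by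
  have h : ∀ᵐ ξ : ℝ, fourierL2 memLp_gaussian ξ ≠ 0 := by
    filter_upwards [ae_comp_mul_left (c := (2 * Real.pi)⁻¹) (inv_ne_zero Real.two_pi_pos.ne')
      coeFn_fourier_gaussian] with ξ hξ
    have h3 := fourierL2_two_pi_mul memLp_gaussian ((2 * Real.pi)⁻¹ * ξ)
    rw [mul_inv_cancel_left₀ Real.two_pi_pos.ne', hξ] at h3
    rw [h3]
    exact mul_ne_zero (by exact_mod_cast normFactor_pos.ne') (by exact_mod_cast (gaussianHat_pos _).ne')
  refine eq_univ_of_forall fun ξ U hU => ?_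
  have e : (U ∩ {η | fourierL2 memLp_gaussian η ≠ 0} : Set ℝ) =ᵐ[volume] U := by
    filter_upwards [h] with η hη
    exact propext ⟨fun h => h.1, fun h => ⟨h, hη⟩⟩
  rw [measure_congr e]
  exact (Measure.measure_pos_of_mem_nhds volume hU).ne'

/-- The samples are even absolutely summable. This is the input for interpolating a Gaussian
translate at the integers. -/
lemma memℓp_gaussian_sub (y : ℝ) : Memℓp (fun k : ℤ => gaussian (k - y)) 2 := by
  have h1 : Summable fun k : ℤ => ‖gaussian (k - y)‖ := by
    refine Summable.of_nonneg_of_le (fun _ => norm_nonneg _) (fun k => ?_)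
      (summable_exp_sub_abs (1 + |y|))
    rw [gaussian, Complex.norm_real, Real.norm_of_nonneg (Real.exp_nonneg _)]
    exact exp_neg_sq_le (by linarith [abs_sub_abs_le_abs_sub (k : ℝ) y])
  have h2 : Memℓp (fun k : ℤ => gaussian (k - y)) 1 := memℓp_gen (by simpa using h1)
  exact h2.of_exponent_ge (by norm_num)

lemma memLp_gaussian_sub (y : ℝ) : MemLp (fun x => gaussian (x - y)) 2 :=
  memLp_gaussian.comp_measurePreserving (measurePreserving_sub_right volume y)

/-! ### Gaussian translates out of reach -/

/-- Translates of the Gaussian by a non-half-integer are not limits in `L₂` of functions from the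
integer shift spaces of regular generators. -/
lemma not_tendsto_gaussian_sub {A : Type*} {l : Filter A} [l.NeBot] {φ : A → ℝ → ℂ}
    (hφ : ∀ α, IsRegularGenerator (φ α)) {u : A → Lp ℂ 2 (volume : Measure ℝ)}
    (hu : ∀ α, u α ∈ quasiShiftSpace (φ α) fun j : ℤ => (j : ℝ)) {y : ℝ}
    (hy : ∀ n : ℤ, 2 * y ≠ n) :
    ¬ Tendsto u l (𝓝 ((memLp_gaussian_sub y).toLp _)) := by
  intro hlim
  choose h δ M hw hH using fun α => (hφ α).exists_window
  have hu' : ∀ α, u α ∈ windowSubmodule (h α) := fun α => by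
    rw [← (hw α).quasiShiftSpace_eq (hφ α).memLp (hH α)]; exact hu α
  have hphase := fourier_phase_of_tendsto hw hu' hlim
  obtain ⟨δ', M', hw'⟩ := exists_window_gaussianHat
  have hf := ae_cell_shift (fourier_translate memLp_gaussian hw'.integrable_memLp.1
    coeFn_fourier_gaussian (memLp_gaussian_sub y).coeFn_toLp)
  have : (ae cellMeasure).NeBot := by
    rw [ae_neBot, Ne, Measure.restrict_eq_zero, cell, Real.volume_Ioc]
    norm_num
  -- The cell has positive measure, so a single generic point exists, and it already gives the
  -- contradiction.
  obtain ⟨t, h1, h2⟩ := (hphase.and hf).exists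
  have h3 := h2 0
  have h4 := h2 1
  rw [Int.cast_zero, add_zero] at h3
  rw [Int.cast_one] at h4
  beta_reduce at h3 h4
  rw [h3, h4, map_mul, Complex.conj_ofReal, expo_add_right] at h1
  -- The modulations at `t` cancel, leaving a positive number times `exp(-2πiy)`; its imaginary part
  -- must vanish, which makes `2y` an integer.
  have e : (gaussianHat (t + 1) : ℂ) * (expo (-y) t * expo (-y) 1) *
      (gaussianHat t * starRingEnd ℂ (expo (-y) t)) =
      ((gaussianHat (t + 1) * gaussianHat t : ℝ) : ℂ) * expo (-y) 1 := by
    have h5 : expo (-y) t * starRingEnd ℂ (expo (-y) t) = 1 := by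
      rw [Complex.mul_conj, Complex.normSq_eq_norm_sq, norm_expo]; simp
    push_cast
    linear_combination (gaussianHat (t + 1) : ℂ) * expo (-y) 1 * gaussianHat t * h5
  rw [e] at h1
  have h6 := (Complex.le_def.1 h1).2
  rw [Complex.im_ofReal_mul, Complex.zero_im] at h6
  have h7 : (expo (-y) 1).im = 0 :=
    (mul_eq_zero.1 h6.symm).resolve_left (mul_pos (gaussianHat_pos _) (gaussianHat_pos _)).ne'
  have h8 : expo (-y) 1 = Complex.exp (((-(2 * y) * Real.pi : ℝ) : ℂ) * Complex.I) := by
    rw [expo]; congr 1; push_cast; ring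
  rw [h8, Complex.exp_ofReal_mul_I_im, Real.sin_eq_zero_iff] at h7
  obtain ⟨n, hn⟩ := h7
  have h9 : (n : ℝ) = -(2 * y) := mul_right_cancel₀ Real.pi_ne_zero hn
  exact hy (-n) (by push_cast; linarith)

/-- Interpolants at the integers of functions with square summable samples exist and are unique. -/
lemma IsRegularGenerator.existsUnique_interpolant {φ : ℝ → ℂ} (hφ : IsRegularGenerator φ)
    {f : ℝ → ℂ} (hf : Memℓp (fun k : ℤ => f k) 2) :
    ∃! g : ℝ → ℂ, IsInterpolant φ (fun j : ℤ => (j : ℝ)) f g := by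
  obtain ⟨h, δ, M, hw, hH⟩ := hφ.exists_window
  obtain ⟨g, hg, hgk⟩ := hw.exists_memWindow hf
  refine ⟨g, ⟨(hw.memV_iff hφ.memLp hH).2 hg, hgk⟩, fun g' hg' => ?_⟩
  exact hw.eq_of_memWindow ((hw.memV_iff hφ.memLp hH).1 hg'.1) hg fun k => by
    rw [hgk k]; exact hg'.2 k

/-! ### The perturbed node sequence -/

/-- The integers with `1` replaced by `√2`. -/
def perturbedIntegers (j : ℤ) : ℝ := if j = 1 then √2 else j

lemma sqrt_two_mem_Ioo : 1 < √2 ∧ √2 < 2 :=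
  ⟨by rw [Real.lt_sqrt] <;> norm_num, by rw [Real.sqrt_lt'] <;> norm_num⟩

lemma sqrt_two_ne_int (k : ℤ) : √2 ≠ k := irrational_sqrt_two.ne_int k

lemma strictMono_perturbedIntegers : StrictMono perturbedIntegers := by
  obtain ⟨h1, h2⟩ := sqrt_two_mem_Ioo
  refine strictMono_int_of_lt_succ fun j => ?_
  unfold perturbedIntegers
  split_ifs with h3 h4 h4
  · omega
  · subst h3; norm_num
  · have : j = 0 := by omega
    subst this; norm_num
  · push_cast; linarith

lemma range_perturbedIntegers :
    range perturbedIntegers = (range (fun j : ℤ => (j : ℝ)) \ {1}) ∪ {√2} := by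
  ext x
  constructor
  · rintro ⟨j, rfl⟩
    unfold perturbedIntegers
    split_ifs with h
    · right; rfl
    · left; exact ⟨⟨j, rfl⟩, by simpa using h⟩
  · rintro (⟨⟨j, rfl⟩, h⟩ | h)
    · refine ⟨j, if_neg ?_⟩
      simpa using h
    · exact ⟨1, by rw [mem_singleton_iff.1 h]; exact if_pos rfl⟩

lemma range_perturbedIntegers_ne : range perturbedIntegers ≠ range fun j : ℤ => (j : ℝ) := by
  intro h
  have : √2 ∈ range perturbedIntegers := ⟨1, if_pos rfl⟩
  rw [h] at this
  obtain ⟨k, hk⟩ := this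
  exact sqrt_two_ne_int k hk.symm

end QuasiShift

end

/-! ### The counterexample -/

theorem mainTheorem6 :
    ∃ (ψ : ℝ → ℂ) (X Y : ℤ → ℝ),
      (∀ x : ℝ, ψ x = ((Real.exp (-x ^ 2) : ℝ) : ℂ)) ∧
      (∀ j : ℤ, Y j = (j : ℝ)) ∧
      StrictMono X ∧
      Set.range X = (Set.range (fun j : ℤ => (j : ℝ)) \ {1}) ∪ {Real.sqrt 2} ∧
      Set.range X ≠ Set.range Y ∧
      QuasiShift.IsCIS X ∧ QuasiShift.IsCIS Y ∧
      (∃ hψ : QuasiShift.IsRegularGenerator ψ,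
        Set.Icc (-Real.pi) Real.pi ⊂
          QuasiShift.essSupport (QuasiShift.fourierL2 hψ.memLp)) ∧
      ∀ (A : Type*) (l : Filter A) [l.NeBot] (φ : A → ℝ → ℂ),
        (∀ α, QuasiShift.IsRegularGenerator (φ α)) →
        ∃ f : ℝ → ℂ, QuasiShift.MemV ψ X f ∧
          (∀ α, ∃! g : ℝ → ℂ, QuasiShift.IsInterpolant (φ α) Y f g) ∧
          ∀ g : A → ℝ → ℂ, (∀ α, QuasiShift.IsInterpolant (φ α) Y f (g α)) →
            ¬ QuasiShift.ConvergesL2AndUniformly l g f := by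
  open QuasiShift in
  refine ⟨gaussian, perturbedIntegers, fun j => (j : ℝ), fun _ => rfl, fun _ => rfl,
    strictMono_perturbedIntegers, range_perturbedIntegers, range_perturbedIntegers_ne,
    isCIS_update 1 sqrt_two_ne_int, isCIS_int, ⟨isRegularGenerator_gaussian, ?_⟩, ?_⟩
  · rw [essSupport_gaussian]
    refine ssubset_univ_iff.2 fun h => ?_
    have := h.symm ▸ mem_univ (Real.pi + 1)
    linarith [this.2]
  · intro A l _ φ hφ
    -- The witness is the generator translated to the new node, the same function for every family
    -- and filter.
    refine ⟨fun x => gaussian (x - √2), ⟨continuous_gaussian.comp (continuous_sub_right _),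
      memLp_gaussian_sub _, ?_⟩, fun α => (hφ α).existsUnique_interpolant (memℓp_gaussian_sub _),
      fun g hg hconv => ?_⟩
    · refine Submodule.le_topologicalClosure _ (Submodule.subset_span ⟨1, ?_⟩)
      exact (memLp_gaussian_sub (√2)).coeFn_toLp
    · choose hgm hgV using fun α => (hg α).1.2
      -- Convergence in `L₂` alone is contradictory, since `2√2` is irrational.
      refine not_tendsto_gaussian_sub (l := l) hφ hgV (y := √2) (fun n hn => ?_) ?_
      · exact irrational_sqrt_two ⟨(n : ℚ) / 2, by push_cast; linarith⟩
      · rw [Lp.tendsto_Lp_iff_tendsto_eLpNorm'']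
        refine hconv.1.congr fun α => ?_
        rw [eLpNorm_sub_comm]
        rfl
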